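/- Let $\Omega\subset\mathbb R^2$ be a polygonal domain (a bounded domain whose boundary is a finite union of segments) and let $\mathcal T$ be a conforming decomposition of $\Omega$ into finitely many polygons: the elements $K\in\mathcal T$ are pairwise disjoint open subsets of $\Omega$, each the interior of a simple closed polygon with $N^K$ vertices (collinear consecutive vertices, i.e. hanging nodes, are allowed), the closures $\overline K$ cover $\overline\Omega$, and any two edges of the mesh either coincide or meet at most in a common endpoint. Let $\mathcal V^K$ be the set of vertices of $K$ and $\mathcal V=\bigcup_K\mathcal V^K$. Let $p\ge 1$ be an integer, let $\mathbb P_k$ be the space of real bivariate polynomials of degree at most $k$ (with $\mathbb P_{-1}=\{0\}$), and for every $K$ fix any basis $\{m^K_\alpha\}_{|\alpha|\le p-2}$ of $\mathbb P_{p-2}$. Set $$V(K)=\{v\in C^0(\overline K):\ v|_e\in\mathbb P_p(e)\text{ for every edge } e \text{ of } K,\ \Delta v\in\mathbb P_{p-2}\text{ in } K\},$$ $$V=\{v\in C^0(\overline\Omega):\ v|_K\in V(K)\text{ for all }K\in\mathcal T\},$$ where $\Delta v$ is understood in the sense of distributions. Then for every $\nu\in\mathcal V$ there is exactly one function $\varphi_\nu\in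 V$ such that 1. $\varphi_\nu(\nu)=1$, $\varphi_\nu(\mu)=0$ for every $\mu\in\mathcal V\setminus\{\nu\}$, and $\varphi_\nu$ is affine on every edge of the mesh; 2. for every $K\in\mathcal T$ with $\nu\in\mathcal V^K$ and all $|\alpha|\le p-2$, $\displaystyle \frac1{|K|}\int_K\varphi_\nu\, m^K_\alpha=\frac1{N^K|K|}\int_K m^K_\alpha$; 3. $\varphi_\nu=0$ on $\overline K$ for every $K\in\mathcal T$ with $\nu\notin\mathcal V^K$. These functions form a partition of unity: $\sum_{\nu\in\mathcal V}\varphi_\nu=1$ on $\overline\Omega$. -/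

import Mathlib

open Set MeasureTheory
open scoped ContDiff

noncomputable section

namespace VEM

/-- The Euclidean plane. -/
abbrev Plane : Type := EuclideanSpace ℝ (Fin 2)

/-- The pair of endpoints of the `a`-th edge of a closed polygonal chain. -/
def edgeEnds {n : ℕ} (P : Polygon Plane n) (a : Fin n) : Set Plane :=
  {P a, P (finRotate n a)}

/-- The chain is a simple closed polygon: distinct vertices, and two distinct edges meet at most in
a common endpoint. Three consecutive vertices may be collinear (hanging nodes are vertices). -/
structure IsSimplePolygon {n : ℕ} (P : Polygon Plane n) : Prop where
  three_le : 3 ≤ n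
  injective : Function.Injective P.vertices
  inter : ∀ a b : Fin n, a ≠ b → P.edgeSet ℝ a ∩ P.edgeSet ℝ b ⊆ edgeEnds P a ∩ edgeEnds P b

/-- A polygonal element: the bounded connected open set `carrier` enclosed by a simple closed
polygon with `numVertices` vertices. -/
structure Element where
  numVertices : ℕ
  polygon : Polygon Plane numVertices
  simple : IsSimplePolygon polygon
  carrier : Set Plane
  isOpen : IsOpen carrier
  isConnected : IsConnected carrier
  isBounded : Bornology.IsBounded carrier
  frontier_eq : frontier carrier = polygon.boundary ℝ

/-- The set of vertices of an element. -/
def Element.vertexSet (K : Element) : Set Plane := range K.polygon.vertices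

/-- A polygonal domain: a bounded domain whose boundary is a finite union of line segments. -/
structure IsPolygonalDomain (Ω : Set Plane) : Prop where
  isOpen : IsOpen Ω
  isConnected : IsConnected Ω
  isBounded : Bornology.IsBounded Ω
  frontier_eq : ∃ S : Finset (Plane × Plane),
    (∀ e ∈ S, e.1 ≠ e.2) ∧ frontier Ω = ⋃ e ∈ S, segment ℝ e.1 e.2

/-- A conforming decomposition of `Ω` into polygons: two edges of the mesh (of the same or of
different elements) either coincide or meet at most in a common endpoint. -/
structure Mesh (ι : Type*) (Ω : Set Plane) where
  elem : ι → Element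
  subset : ∀ i, (elem i).carrier ⊆ Ω
  disjoint : ∀ i j, i ≠ j → Disjoint (elem i).carrier (elem j).carrier
  closure_eq : closure Ω = ⋃ i, closure (elem i).carrier
  conforming : ∀ (i j : ι) (a : Fin (elem i).numVertices) (b : Fin (elem j).numVertices),
    (elem i).polygon.edgeSet ℝ a = (elem j).polygon.edgeSet ℝ b ∨
    (elem i).polygon.edgeSet ℝ a ∩ (elem j).polygon.edgeSet ℝ b ⊆
      edgeEnds (elem i).polygon a ∩ edgeEnds (elem j).polygon b

open Classical in
/-- The set of all vertices of the mesh. -/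
def Mesh.vertices {ι : Type*} [Fintype ι] {Ω : Set Plane} (T : Mesh ι Ω) : Finset Plane :=
  Finset.univ.biUnion fun i => Finset.univ.image (T.elem i).polygon.vertices

/-- Bivariate polynomials of total degree at most the integer `k`; the zero space if `k < 0`. -/
abbrev Poly (k : ℤ) : Submodule ℝ (MvPolynomial (Fin 2) ℝ) :=
  MvPolynomial.restrictSupport ℝ {α : Fin 2 →₀ ℕ | (α.degree : ℤ) ≤ k}

/-- The function on the plane given by a polynomial. -/
def polyFun (q : MvPolynomial (Fin 2) ℝ) (x : Plane) : ℝ := MvPolynomial.eval (fun j => x j) q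

/-- `Δ v = g` in the open set `K` in the sense of distributions. -/
def HasWeakLaplacian (v g : Plane → ℝ) (K : Set Plane) : Prop :=
  ∀ η : Plane → ℝ, ContDiff ℝ ∞ η → HasCompactSupport η → tsupport η ⊆ K →
    ∫ x in K, v x * Laplacian.laplacian η x = ∫ x in K, g x * η x

/-- The local nodal virtual element space of degree `p` on `K`. Only the values of `v` on the
closure of `K` matter. -/
structure IsLocalVEM (p : ℕ) (K : Element) (v : Plane → ℝ) : Prop where
  continuousOn : ContinuousOn v (closure K.carrier)
  edge : ∀ a : Fin K.numVertices, ∃ P : Polynomial ℝ, P.natDegree ≤ p ∧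
    ∀ t ∈ Icc (0 : ℝ) 1, v (K.polygon.edgePath ℝ a t) = P.eval t
  laplacian : ∃ q ∈ Poly ((p : ℤ) - 2), HasWeakLaplacian v (polyFun q) K.carrier

/-- The global nodal virtual element space of degree `p`. Only the values of `v` on the closure
of `Ω` matter. -/
def Mesh.space {ι : Type*} {Ω : Set Plane} (T : Mesh ι Ω) (p : ℕ) : Set (Plane → ℝ) :=
  {v | ContinuousOn v (closure Ω) ∧ ∀ i, IsLocalVEM p (T.elem i) v}

/-- A choice, on every element, of a basis of the polynomials of degree at most `p - 2`, indexed by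
the multi-indices of length at most `p - 2`. -/
abbrev Mesh.MomentBasis {ι : Type*} {Ω : Set Plane} (_T : Mesh ι Ω) (p : ℕ) :=
  ι → Module.Basis {α : Fin 2 →₀ ℕ // (α.degree : ℤ) ≤ (p : ℤ) - 2} ℝ (Poly ((p : ℤ) - 2))

/-- `φ` is the virtual element function attached to the vertex `ν`. -/
structure Mesh.IsVertexFunction {ι : Type*} [Fintype ι] {Ω : Set Plane} (T : Mesh ι Ω) (p : ℕ)
    (m : T.MomentBasis p) (ν : Plane) (φ : Plane → ℝ) : Prop where
  mem_space : φ ∈ T.space p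
  at_self : φ ν = 1
  at_other : ∀ μ ∈ T.vertices, μ ≠ ν → φ μ = 0
  /-- `φ` is affine on every edge of the mesh. -/
  affine : ∀ (i : ι) (a : Fin (T.elem i).numVertices), ∀ t ∈ Icc (0 : ℝ) 1,
    φ ((T.elem i).polygon.edgePath ℝ a t) =
      (1 - t) * φ ((T.elem i).polygon a) + t * φ ((T.elem i).polygon (finRotate _ a))
  moments : ∀ i, ν ∈ (T.elem i).vertexSet → ∀ α,
    1 / volume.real (T.elem i).carrier *
        ∫ x in (T.elem i).carrier, φ x * polyFun (m i α) x =
      1 / (((T.elem i).numVertices : ℝ) * volume.real (T.elem i).carrier) *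
        ∫ x in (T.elem i).carrier, polyFun (m i α) x
  eq_zero : ∀ i, ν ∉ (T.elem i).vertexSet → ∀ x ∈ closure (T.elem i).carrier, φ x = 0

end VEM

end

/-! The theorem reduces to unisolvence on a single element `K`: a function of the local space is
determined by its boundary values and its moments against $\mathbb P_{p-2}$, and these data can be
prescribed freely as long as the boundary values are continuous.

Uniqueness is an energy argument. If $d$ vanishes on $\partial K$, has vanishing moments and $\Delta
d=q\in\mathbb P_{p-2}$, then $\int_K d\,q=0$, so formally $\int_K|\nabla d|^2=0$. Two points need
care. The equation holds only weakly, so $d$ is compared with a smooth solution of the same problem;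
the difference is weakly harmonic and vanishes by mollification and the maximum principle
(`eq_zero_of_hasWeakLaplacian_zero`). Moreover nothing is known about gradients at the boundary, so
Green's formula is applied to truncations supported inside `K`
(`eq_zero_of_integral_mul_laplacian_eq_zero`).

For existence, let $u_i$ vanish on $\partial K$ with $\Delta u_i=m_i$. The square matrix of moments
of the $u_i$ is injective by the same energy argument, hence surjective, and a combination of the
$u_i$ corrects the moments of the harmonic extension of the boundary data
(`exists_hasWeakLaplacian_of_moments`). The $u_i$ come from a polynomial with Laplacian $m_i$ minus
a harmonic function. The Dirichlet problem is solved by sweeping out with Poisson integrals; every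
boundary point ends a segment lying outside `K`, and the branch of a square root cut along that
segment supplies a barrier.

Globally, conformity makes the piecewise affine hat function on the skeleton well defined, so the
local solutions glue. For the partition of unity, the sum of the vertex functions has trace 1 on
each edge, and its moments on `K` consist of $N^K$ equal terms with factor $1/N^K$. These are the
data of the constant 1, so unisolvence concludes. -/

namespace VEM

open Filter Topology Metric Real InnerProductSpace

/-! ### Locally submean functions and the maximum principle -/

/-- The value at each point of `U` is at most the averages over the small circles around it. -/
def IsLocallySubmean (f : ℂ → ℝ) (U : Set ℂ) : Prop :=
  ∀ x ∈ U, ∀ᶠ r in 𝓝[>] (0 : ℝ), f x ≤ circleAverage f x r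

lemma eventually_closedBall_subset {U : Set ℂ} (hU : IsOpen U) {x : ℂ} (hx : x ∈ U) :
    ∀ᶠ r in 𝓝[>] (0 : ℝ), closedBall x r ⊆ U := by
  obtain ⟨e, he, h⟩ := Metric.isOpen_iff.1 hU x hx
  filter_upwards [Ioo_mem_nhdsGT he] with r hr
  exact (closedBall_subset_ball hr.2).trans h

lemma circleIntegrable_of_closedBall_subset {f : ℂ → ℝ} {U : Set ℂ} (hf : ContinuousOn f U) {x : ℂ}
    {r : ℝ} (hr : 0 ≤ r) (h : closedBall x r ⊆ U) : CircleIntegrable f x r :=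
  (hf.mono (sphere_subset_closedBall.trans h)).circleIntegrable hr

lemma IsLocallySubmean.mono {f : ℂ → ℝ} {U V : Set ℂ} (hf : IsLocallySubmean f U) (h : V ⊆ U) :
    IsLocallySubmean f V := fun x hx => hf x (h hx)

lemma HarmonicOnNhd.eventually_circleAverage_eq {f : ℂ → ℝ} {U : Set ℂ} (hU : IsOpen U)
    (hf : HarmonicOnNhd f U) {x : ℂ} (hx : x ∈ U) :
    ∀ᶠ r in 𝓝[>] (0 : ℝ), circleAverage f x r = f x := by
  filter_upwards [eventually_closedBall_subset hU hx, self_mem_nhdsWithin] with r hr h0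
  refine InnerProductSpace.HarmonicOnNhd.circleAverage_eq (hf.mono ?_)
  rwa [abs_of_pos h0]

lemma IsLocallySubmean.of_harmonicOnNhd {f : ℂ → ℝ} {U : Set ℂ} (hU : IsOpen U)
    (hf : HarmonicOnNhd f U) : IsLocallySubmean f U := fun x hx => by
  filter_upwards [HarmonicOnNhd.eventually_circleAverage_eq hU hf hx] with r hr
  exact hr.ge

lemma IsLocallySubmean.add {f g : ℂ → ℝ} {U : Set ℂ} (hU : IsOpen U) (hf : IsLocallySubmean f U)
    (hg : IsLocallySubmean g U) (cf : ContinuousOn f U) (cg : ContinuousOn g U) :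
    IsLocallySubmean (f + g) U := fun x hx => by
  filter_upwards [hf x hx, hg x hx, eventually_closedBall_subset hU hx, self_mem_nhdsWithin]
    with r h1 h2 h3 h4
  rw [circleAverage_add (circleIntegrable_of_closedBall_subset cf (le_of_lt h4) h3)
    (circleIntegrable_of_closedBall_subset cg (le_of_lt h4) h3)]
  exact add_le_add h1 h2

/-- By continuity, strict inequality at the single point `x + r`, the parameter $\theta=0$, already
makes the integral strictly smaller. -/
lemma circleAverage_lt_of_le_of_lt {f : ℂ → ℝ} {x : ℂ} {r M : ℝ} (hr : 0 ≤ r)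
    (hf : ContinuousOn f (sphere x r)) (h : ∀ y ∈ sphere x r, f y ≤ M) (hlt : f (x + r) < M) :
    circleAverage f x r < M := by
  have key : ∫ θ in (0:ℝ)..2 * π, f (circleMap x r θ) < ∫ _ in (0:ℝ)..2 * π, M := by
    apply intervalIntegral.integral_lt_integral_of_continuousOn_of_le_of_exists_lt two_pi_pos
    · exact hf.comp (continuous_circleMap x r).continuousOn
        fun θ _ => circleMap_mem_sphere x hr θ
    · fun_prop
    · exact fun θ _ => h _ (circleMap_mem_sphere x hr θ)
    · exact ⟨0, ⟨le_rfl, two_pi_pos.le⟩, by simpa [circleMap] using hlt⟩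
  rw [circleAverage_def, smul_eq_mul]
  calc _ < (2 * π)⁻¹ * ∫ _ in (0:ℝ)..2 * π, M := by gcongr
    _ = M := by
      simp only [intervalIntegral.integral_const, smul_eq_mul, sub_zero]
      field_simp

/-- The maximum principle. -/
lemma IsLocallySubmean.le_of_le_frontier {f : ℂ → ℝ} {U : Set ℂ} (hU : IsOpen U)
    (hb : Bornology.IsBounded U) (hf : IsLocallySubmean f U) (cf : ContinuousOn f (closure U))
    {M : ℝ} (hM : ∀ x ∈ frontier U, f x ≤ M) : ∀ x ∈ closure U, f x ≤ M := by
  have hc : IsCompact (closure U) := hb.isCompact_closure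
  intro x hx
  obtain ⟨x₀, hx₀, hmax⟩ := hc.exists_isMaxOn ⟨x, hx⟩ cf
  refine (hmax hx).trans ?_
  by_contra! hlt
  have hS : IsCompact (closure U ∩ f ⁻¹' {f x₀}) :=
    hc.of_isClosed_subset (cf.preimage_isClosed_of_isClosed isClosed_closure isClosed_singleton)
      inter_subset_left
  -- Among all maximum points take one with the largest real part. The point `y + r` of a small
  -- circle lies further right, so it is not a maximum point, and the circle average drops strictly
  -- below the maximum.
  obtain ⟨y, ⟨hy, hfy⟩, hymax⟩ := hS.exists_isMaxOn ⟨x₀, hx₀, rfl⟩ Complex.continuous_re.continuousOn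
  have hfy : f y = f x₀ := hfy
  have hyU : y ∈ U := by
    by_contra hn
    have : y ∈ frontier U := by rw [hU.frontier_eq]; exact ⟨hy, hn⟩
    linarith [hM y this]
  obtain ⟨r, h1, h2, h3⟩ := ((hf y hyU).and
    ((eventually_closedBall_subset hU hyU).and self_mem_nhdsWithin)).exists
  have h3 : 0 < r := h3
  have hsub : sphere y r ⊆ closure U := (sphere_subset_closedBall.trans h2).trans subset_closure
  refine absurd h1 (not_le.2 (circleAverage_lt_of_le_of_lt h3.le (cf.mono hsub)
    (fun z hz => hfy ▸ hmax (hsub hz)) ?_))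
  have hmem : y + r ∈ closure U := hsub (by simp [h3.le])
  refine lt_of_le_of_ne (hfy ▸ hmax hmem) fun heq => ?_
  have := hymax (show y + r ∈ closure U ∩ f ⁻¹' {f x₀} from ⟨hmem, by simp [heq, hfy]⟩)
  simp at this
  linarith

/-! ### The Poisson integral on a disc -/

/-- The Poisson integral of `f` over the circle with centre `c` and radius `R`. -/
noncomputable def poissonIntegral (c : ℂ) (R : ℝ) (f : ℂ → ℝ) (w : ℂ) : ℝ :=
  circleAverage (poissonKernel c w • f) c R

lemma continuousOn_poissonKernel {c w : ℂ} {R : ℝ} (hw : w ∈ ball c R) :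
    ContinuousOn (poissonKernel c w) (sphere c R) := by
  have h0 : 0 < R := pos_of_mem_ball hw
  rw [poissonKernel_eq_re_herglotzRieszKernel]
  have := continuousOn_herglotzRieszKernel_sphere hw
  rw [abs_of_pos h0] at this
  exact Complex.continuous_re.comp_continuousOn this

lemma poissonKernel_nonneg {c w z : ℂ} {R : ℝ} (hw : w ∈ ball c R) (hz : z ∈ sphere c R) :
    0 ≤ poissonKernel c w z := by
  rw [poissonKernel_def]
  have h1 : ‖w - c‖ < R := by simpa [dist_eq_norm] using hw
  have h2 : ‖z - c‖ = R := by simpa [dist_eq_norm] using hz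
  rw [h2]
  have := norm_nonneg (w - c)
  apply div_nonneg _ (by positivity)
  nlinarith

lemma circleIntegrable_poissonKernel_smul {f : ℂ → ℝ} {c w : ℂ} {R : ℝ} (hw : w ∈ ball c R)
    (hf : CircleIntegrable f c R) : CircleIntegrable (poissonKernel c w • f) c R := by
  have h0 : 0 < R := pos_of_mem_ball hw
  exact hf.continuousOn_smul (by simpa [abs_of_pos h0] using continuousOn_poissonKernel hw)

lemma poissonIntegral_mono {f g : ℂ → ℝ} {c w : ℂ} {R : ℝ} (hw : w ∈ ball c R)
    (hf : CircleIntegrable f c R) (hg : CircleIntegrable g c R)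
    (h : ∀ z ∈ sphere c R, f z ≤ g z) : poissonIntegral c R f w ≤ poissonIntegral c R g w := by
  have h0 : 0 < R := pos_of_mem_ball hw
  refine circleAverage_mono (circleIntegrable_poissonKernel_smul hw hf)
    (circleIntegrable_poissonKernel_smul hw hg) fun z hz => ?_
  rw [abs_of_pos h0] at hz
  exact mul_le_mul_of_nonneg_left (h z hz) (poissonKernel_nonneg hw hz)

lemma poissonIntegral_neg {f : ℂ → ℝ} {c w : ℂ} {R : ℝ} :
    poissonIntegral c R (-f) w = -poissonIntegral c R f w := by
  have : poissonKernel c w • (-f) = (-1 : ℝ) • (poissonKernel c w • f) := by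
    ext z; simp
  rw [poissonIntegral, this, circleAverage_smul]
  simp [poissonIntegral]

/-- The Poisson kernel is the real part of the Herglotz–Riesz kernel, which is holomorphic in `w`.
The circle is translated to centre 0 to use the analyticity of the corresponding average. -/
lemma harmonicOnNhd_poissonIntegral {f : ℂ → ℝ} {c : ℂ} {R : ℝ} (hf : CircleIntegrable f c R) :
    HarmonicOnNhd (poissonIntegral c R f) (ball c R) := by
  intro w hw
  have hg : CircleIntegrable (fun z => f (z + c)) 0 R := by
    simpa [CircleIntegrable, circleMap, add_comm] using hf
  have hg' : CircleIntegrable (fun z => (f (z + c) : ℂ)) 0 R := by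
    simp only [CircleIntegrable, intervalIntegrable_iff] at hg ⊢
    exact Complex.ofRealCLM.integrable_comp hg
  set F : ℂ → ℂ := fun w => circleAverage (fun ζ => herglotzRieszKernel 0 w ζ • (f (ζ + c) : ℂ)) 0 R
  have hF : AnalyticOnNhd ℂ F (ball 0 R) := analyticOnNhd_circleAverage_herglotzRieszKernel_smul hg'
  have heq : ∀ v ∈ ball c R, poissonIntegral c R f v = (F (v - c)).re := by
    intro v hv
    have hv' : v - c ∈ ball (0 : ℂ) R := by simpa [dist_eq_norm] using hv
    rw [re_circleAverage_herglotzRieszKernel_smul hg hv', poissonIntegral,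
      ← circleAverage_map_add_const]
    congr 1
    ext z
    simp [poissonKernel_eq_re_herglotzRieszKernel, herglotzRieszKernel_add_const]
  have han : AnalyticAt ℂ (fun v => F (v - c)) w := by
    have : AnalyticAt ℂ F (w - c) := hF _ (by simpa [dist_eq_norm] using hw)
    exact this.comp_of_eq (by fun_prop) rfl
  refine (harmonicAt_congr_nhds ?_).2 han.harmonicAt_re
  filter_upwards [isOpen_ball.mem_nhds hw] with v hv using heq v hv

lemma poissonIntegral_eq_self {f : ℂ → ℝ} {c w : ℂ} {R : ℝ} (hf : HarmonicContOnCl f (ball c R))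
    (hw : w ∈ ball c R) : poissonIntegral c R f w = f w :=
  hf.circleAverage_poissonKernel_smul hw

/-- The squared distance to a point of a circle agrees on that circle with a harmonic function. -/
lemma norm_sub_sq_eq_on_sphere {c z₀ z : ℂ} {R : ℝ} (h₀ : z₀ ∈ sphere c R) (hz : z ∈ sphere c R) :
    ‖z - z₀‖ ^ 2 = (2 * R ^ 2 - 2 * (z - c) * (starRingEnd ℂ) (z₀ - c)).re := by
  have h1 : Complex.normSq (z - c) = R ^ 2 := by
    rw [Complex.normSq_eq_norm_sq, ← dist_eq_norm, mem_sphere.1 hz]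
  have h2 : Complex.normSq (z₀ - c) = R ^ 2 := by
    rw [Complex.normSq_eq_norm_sq, ← dist_eq_norm, mem_sphere.1 h₀]
  have hR : ((R : ℂ) ^ 2).re = R ^ 2 := by norm_cast
  rw [← Complex.normSq_eq_norm_sq]
  simp only [Complex.normSq_apply, Complex.sub_re, Complex.sub_im, Complex.mul_re, Complex.conj_re,
    Complex.conj_im, Complex.mul_im, hR, Complex.re_ofNat, Complex.im_ofNat] at *
  linarith

/-- Continuity handles the points within `d` of `z₀`; further away `2 * M / d ^ 2` makes the
quadratic term at least $2M$, which bounds the oscillation of `f`. -/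
lemma exists_le_add_mul_norm_sq {f : ℂ → ℝ} {S : Set ℂ} (hS : IsCompact S) (hf : ContinuousOn f S)
    {z₀ : ℂ} (h₀ : z₀ ∈ S) {ε : ℝ} (hε : 0 < ε) :
    ∃ C : ℝ, 0 ≤ C ∧ ∀ z ∈ S, f z ≤ f z₀ + ε + C * ‖z - z₀‖ ^ 2 := by
  obtain ⟨d, hd, h⟩ := Metric.continuousOn_iff.1 hf z₀ h₀ ε hε
  obtain ⟨M, hM⟩ := hS.exists_bound_of_continuousOn hf
  have hM0 : 0 ≤ M := (norm_nonneg _).trans (hM z₀ h₀)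
  refine ⟨2 * M / d ^ 2, by positivity, fun z hz => ?_⟩
  rcases lt_or_ge (dist z z₀) d with hlt | hge
  · have := h z hz hlt
    rw [Real.dist_eq] at this
    have h2 : 0 ≤ 2 * M / d ^ 2 * ‖z - z₀‖ ^ 2 := by positivity
    linarith [(abs_lt.1 this).2]
  · have h1 := (abs_le.1 (hM z hz)).2
    have h2 := (abs_le.1 (hM z₀ h₀)).1
    rw [dist_eq_norm] at hge
    have h3 : 2 * M / d ^ 2 * d ^ 2 ≤ 2 * M / d ^ 2 * ‖z - z₀‖ ^ 2 := by gcongr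
    rw [div_mul_cancel₀ _ (by positivity)] at h3
    linarith

/-- On the circle the quadratic majorant of `f` coincides with the harmonic function
$\operatorname{Re}H$, which reproduces itself under the Poisson integral. Positivity of the kernel
gives $Pf\le\operatorname{Re}H$ in the disc, and $\operatorname{Re}H(z_0)$ is the midpoint of `f z₀`
and `a`. -/
lemma eventually_poissonIntegral_lt {f : ℂ → ℝ} {c z₀ : ℂ} {R : ℝ} (hR : 0 < R)
    (hf : ContinuousOn f (sphere c R)) (h₀ : z₀ ∈ sphere c R) {a : ℝ} (ha : f z₀ < a) :
    ∀ᶠ w in 𝓝[ball c R] z₀, poissonIntegral c R f w < a := by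
  obtain ⟨C, hC, h⟩ := exists_le_add_mul_norm_sq (isCompact_sphere c R) hf h₀
    (half_pos (sub_pos.2 ha))
  set H : ℂ → ℂ := fun z => (f z₀ + (a - f z₀) / 2 : ℝ) +
    C * (2 * R ^ 2 - 2 * (z - c) * (starRingEnd ℂ) (z₀ - c)) with hH
  have hHd : Differentiable ℂ H := by fun_prop
  have hharm : HarmonicContOnCl (fun z => (H z).re) (ball c R) :=
    HarmonicOnNhd.harmonicContOnCl fun z _ => (hHd.analyticAt z).harmonicAt_re
  have hHs : ∀ z ∈ sphere c R, (H z).re = f z₀ + (a - f z₀) / 2 + C * ‖z - z₀‖ ^ 2 := by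
    intro z hz
    rw [norm_sub_sq_eq_on_sphere h₀ hz, ← Complex.re_ofReal_mul, hH]
    simp
  have hle : ∀ w ∈ ball c R, poissonIntegral c R f w ≤ (H w).re := by
    intro w hw
    rw [← poissonIntegral_eq_self hharm hw]
    refine poissonIntegral_mono hw (hf.circleIntegrable hR.le)
      ((Complex.continuous_re.comp hHd.continuous).continuousOn.circleIntegrable hR.le) ?_
    exact fun z hz => (h z hz).trans_eq (hHs z hz).symm
  have hlim : ∀ᶠ w in 𝓝[ball c R] z₀, (H w).re < a := by
    have hc : ContinuousAt (fun w => (H w).re) z₀ :=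
      (Complex.continuous_re.comp hHd.continuous).continuousAt
    refine nhdsWithin_le_nhds (hc.eventually_lt continuousAt_const ?_)
    rw [hHs z₀ h₀]
    simp
    linarith
  filter_upwards [hlim, self_mem_nhdsWithin] with w h1 h2
  exact (hle w h2).trans_lt h1

lemma tendsto_poissonIntegral {f : ℂ → ℝ} {c z₀ : ℂ} {R : ℝ} (hR : 0 < R)
    (hf : ContinuousOn f (sphere c R)) (h₀ : z₀ ∈ sphere c R) :
    Tendsto (poissonIntegral c R f) (𝓝[ball c R] z₀) (𝓝 (f z₀)) := by
  refine tendsto_order.2 ⟨fun a ha => ?_, fun a ha => eventually_poissonIntegral_lt hR hf h₀ ha⟩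
  have := eventually_poissonIntegral_lt hR hf.neg h₀ (a := -a) (by simpa using ha)
  filter_upwards [this] with w hw
  have h2 := poissonIntegral_neg (f := f) (c := c) (w := w) (R := R)
  change poissonIntegral c R (-f) w < -a at hw
  linarith

open Classical in
/-- Replace `f` in a disc by the Poisson integral of its values on the circle. -/
noncomputable def poissonModification (c : ℂ) (R : ℝ) (f : ℂ → ℝ) : ℂ → ℝ :=
  (ball c R).piecewise (poissonIntegral c R f) f

lemma poissonModification_of_mem {c w : ℂ} {R : ℝ} {f : ℂ → ℝ} (hw : w ∈ ball c R) :
    poissonModification c R f w = poissonIntegral c R f w := by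
  classical
  unfold poissonModification
  exact piecewise_eq_of_mem _ _ _ hw

lemma poissonModification_of_notMem {c w : ℂ} {R : ℝ} {f : ℂ → ℝ} (hw : w ∉ ball c R) :
    poissonModification c R f w = f w := by
  classical
  unfold poissonModification
  exact piecewise_eq_of_notMem _ _ _ hw

lemma harmonicOnNhd_poissonModification {c : ℂ} {R : ℝ} {f : ℂ → ℝ}
    (hf : CircleIntegrable f c R) : HarmonicOnNhd (poissonModification c R f) (ball c R) := by
  intro w hw
  refine (harmonicAt_congr_nhds ?_).1 (harmonicOnNhd_poissonIntegral hf w hw)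
  filter_upwards [isOpen_ball.mem_nhds hw] with v hv using (poissonModification_of_mem hv).symm

lemma continuousOn_poissonModification {c : ℂ} {R : ℝ} (hR : 0 < R) {f : ℂ → ℝ} {A : Set ℂ}
    (hA : closedBall c R ⊆ A) (hf : ContinuousOn f A) :
    ContinuousOn (poissonModification c R f) A := by
  have hs : ContinuousOn f (sphere c R) := hf.mono (sphere_subset_closedBall.trans hA)
  intro x hx
  by_cases hxb : x ∈ ball c R
  · exact ((harmonicOnNhd_poissonModification (hs.circleIntegrable hR.le)) x
      hxb).1.continuousAt.continuousWithinAt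
  have hsplit : A ⊆ ball c R ∪ (A \ ball c R) := fun y hy => by
    by_cases h : y ∈ ball c R
    exacts [Or.inl h, Or.inr ⟨hy, h⟩]
  refine ContinuousWithinAt.mono ?_ hsplit
  refine ContinuousWithinAt.union ?_ ?_
  · by_cases hxs : x ∈ sphere c R
    · rw [ContinuousWithinAt, poissonModification_of_notMem hxb]
      refine (tendsto_poissonIntegral hR hs hxs).congr' ?_
      filter_upwards [self_mem_nhdsWithin] with w hw using (poissonModification_of_mem hw).symm
    -- Off the closed disc there is nothing to check along the disc, since the filter `𝓝[ball c R]
    -- x` is trivial.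
    · have hcl : x ∉ closure (ball c R) := by
        rw [closure_ball c hR.ne', ← ball_union_sphere]
        exact fun h => h.elim hxb hxs
      rw [mem_closure_iff_nhdsWithin_neBot, not_neBot] at hcl
      simp [ContinuousWithinAt, hcl]
  · refine ((hf x hx).mono sdiff_subset).congr
      (fun y hy => poissonModification_of_notMem hy.2) (poissonModification_of_notMem hxb)

/-- In the disc, `f` minus its Poisson integral is submean with boundary values 0, so the maximum
principle applies. -/
lemma le_poissonModification {c : ℂ} {R : ℝ} (hR : 0 < R) {f : ℂ → ℝ} {U : Set ℂ}
    (hU : closedBall c R ⊆ U) (cf : ContinuousOn f U) (hf : IsLocallySubmean f U) (x : ℂ) :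
    f x ≤ poissonModification c R f x := by
  by_cases hx : x ∈ ball c R
  swap
  · rw [poissonModification_of_notMem hx]
  have hcl : closure (ball c R) = closedBall c R := closure_ball c hR.ne'
  have hs : ContinuousOn f (sphere c R) := cf.mono (sphere_subset_closedBall.trans hU)
  have hh := harmonicOnNhd_poissonModification (hs.circleIntegrable hR.le)
  have hsub : IsLocallySubmean (f + -poissonModification c R f) (ball c R) :=
    (hf.mono (ball_subset_closedBall.trans hU)).add isOpen_ball
      (.of_harmonicOnNhd isOpen_ball hh.neg) (cf.mono (ball_subset_closedBall.trans hU))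
      hh.neg.continuousOn
  have hcont : ContinuousOn (f + -poissonModification c R f) (closure (ball c R)) := by
    rw [hcl]
    exact (cf.mono hU).add
      (((continuousOn_poissonModification hR hU cf).mono hU).neg)
  have := hsub.le_of_le_frontier isOpen_ball isBounded_ball hcont (M := 0) (fun y hy => ?_) x
    (subset_closure hx)
  · simpa using this
  · rw [isOpen_ball.frontier_eq] at hy
    simp [poissonModification_of_notMem hy.2]

/-- Inside the disc the modification is harmonic. Outside, its value at the centre of a small circle
is still that of `f`, while the values on the circle have only increased. -/
lemma IsLocallySubmean.poissonModification {c : ℂ} {R : ℝ} (hR : 0 < R) {f : ℂ → ℝ} {U : Set ℂ}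
    (hoU : IsOpen U) (hU : closedBall c R ⊆ U) (cf : ContinuousOn f U)
    (hf : IsLocallySubmean f U) : IsLocallySubmean (poissonModification c R f) U := by
  intro x hx
  have hs : ContinuousOn f (sphere c R) := cf.mono (sphere_subset_closedBall.trans hU)
  by_cases hxb : x ∈ ball c R
  · exact IsLocallySubmean.of_harmonicOnNhd isOpen_ball
      (harmonicOnNhd_poissonModification (hs.circleIntegrable hR.le)) x hxb
  · rw [poissonModification_of_notMem hxb]
    filter_upwards [hf x hx, eventually_closedBall_subset hoU hx, self_mem_nhdsWithin]
      with r h1 h2 h3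
    refine h1.trans (circleAverage_mono (circleIntegrable_of_closedBall_subset cf (le_of_lt h3) h2)
      (circleIntegrable_of_closedBall_subset (continuousOn_poissonModification hR hU cf)
        (le_of_lt h3) h2) fun z _ => le_poissonModification hR hU cf hf z)

end VEM

namespace VEM

open Filter Topology Metric Real InnerProductSpace

/-! ### The Dirichlet problem for submean data: balayage -/

/-- A harmonic barrier of `U` at the boundary point `z`. -/
structure IsBarrier (b : ℂ → ℝ) (U : Set ℂ) (z : ℂ) : Prop where
  harmonic : HarmonicContOnCl b U
  apply_self : b z = 0
  pos : ∀ x ∈ closure U, x ≠ z → 0 < b x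

/-- The barrier replaces the quadratic term used on the disc: away from `z` it has a positive
minimum `b y` on the compact frontier, and `2 * M / b y` makes it dominate the oscillation of `g`.
-/
lemma IsBarrier.exists_le {b : ℂ → ℝ} {U : Set ℂ} {z : ℂ} (hbar : IsBarrier b U z)
    (hb : Bornology.IsBounded U) (hz : z ∈ frontier U) {g : ℂ → ℝ}
    (hg : ContinuousOn g (frontier U)) {ε : ℝ} (hε : 0 < ε) :
    ∃ C : ℝ, 0 ≤ C ∧ ∀ x ∈ frontier U, g x ≤ g z + ε + C * b x := by
  have hS : IsCompact (frontier U) :=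
    hb.isCompact_closure.of_isClosed_subset isClosed_frontier frontier_subset_closure
  have hnn : ∀ x ∈ frontier U, 0 ≤ b x := fun x hx => by
    by_cases h : x = z
    · rw [h, hbar.apply_self]
    · exact (hbar.pos x (frontier_subset_closure hx) h).le
  obtain ⟨d, hd, h⟩ := Metric.continuousOn_iff.1 hg z hz ε hε
  obtain ⟨M, hM⟩ := hS.exists_bound_of_continuousOn hg
  have hM0 : 0 ≤ M := (norm_nonneg _).trans (hM z hz)
  have hnear : ∀ x ∈ frontier U, dist x z < d → ∀ C : ℝ, 0 ≤ C → g x ≤ g z + ε + C * b x := by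
    intro x hx hlt C hC
    have h1 := h x hx hlt
    rw [Real.dist_eq] at h1
    have h2 := mul_nonneg hC (hnn x hx)
    linarith [(abs_lt.1 h1).2]
  have hK : IsCompact (frontier U \ ball z d) := hS.diff isOpen_ball
  rcases (frontier U \ ball z d).eq_empty_or_nonempty with he | hne
  · refine ⟨0, le_rfl, fun x hx => hnear x hx ?_ 0 le_rfl⟩
    by_contra hn
    have : x ∈ frontier U \ ball z d := ⟨hx, hn⟩
    simp [he] at this
  obtain ⟨y, hy, hmin⟩ := hK.exists_isMinOn hne
    (hbar.harmonic.2.mono (sdiff_subset.trans frontier_subset_closure))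
  have hby : 0 < b y := hbar.pos y (frontier_subset_closure hy.1) fun h => hy.2 (by simp [h, hd])
  refine ⟨2 * M / b y, by positivity, fun x hx => ?_⟩
  rcases lt_or_ge (dist x z) d with hlt | hge
  · exact hnear x hx hlt _ (by positivity)
  · have h1 := (abs_le.1 (hM x hx)).2
    have h2 := (abs_le.1 (hM z hz)).1
    have h3 : b y ≤ b x := hmin (show x ∈ frontier U \ ball z d from ⟨hx, by simpa using hge⟩)
    have h4 : 2 * M / b y * b y ≤ 2 * M / b y * b x := by gcongr
    rw [div_mul_cancel₀ _ hby.ne'] at h4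
    linarith

lemma IsLocallySubmean.le_add_mul_barrier {b f : ℂ → ℝ} {U : Set ℂ} {z : ℂ}
    (hbar : IsBarrier b U z) (hU : IsOpen U) (hb : Bornology.IsBounded U)
    (hf : IsLocallySubmean f U) (cf : ContinuousOn f (closure U)) {A C : ℝ}
    (h : ∀ x ∈ frontier U, f x ≤ A + C * b x) : ∀ x ∈ closure U, f x ≤ A + C * b x := by
  have hh : HarmonicContOnCl (-C • b) U := hbar.harmonic.const_smul _
  have := (hf.add hU (.of_harmonicOnNhd hU hh.1) (cf.mono subset_closure)
    hh.1.continuousOn).le_of_le_frontier hU hb (cf.add hh.2) (M := A)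
    (fun x hx => by have := h x hx; simp; linarith)
  intro x hx
  have := this x hx
  simp at this
  linarith

lemma exists_seq_ball_cover {U : Set ℂ} (hU : IsOpen U) (hne : U.Nonempty) :
    ∃ (c : ℕ → ℂ) (R : ℕ → ℝ), (∀ n, 0 < R n) ∧ (∀ n, closedBall (c n) (R n) ⊆ U) ∧
      ∀ x ∈ U, ∃ n, x ∈ ball (c n) (R n) := by
  have h : ∀ x : U, ∃ r : ℝ, 0 < r ∧ closedBall (x : ℂ) r ⊆ U := fun x => by
    obtain ⟨r, h1, h2⟩ := ((eventually_closedBall_subset hU x.2).and self_mem_nhdsWithin).exists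
    exact ⟨r, h2, h1⟩
  choose r hr hsub using h
  obtain ⟨T, hT, hTU⟩ := TopologicalSpace.isOpen_iUnion_countable
    (fun x : U => ball (x : ℂ) (r x)) fun _ => isOpen_ball
  have hTne : T.Nonempty := by
    obtain ⟨x, hx⟩ := hne
    have : x ∈ ⋃ i ∈ T, ball (i : ℂ) (r i) := by
      rw [hTU]
      exact mem_iUnion.2 ⟨⟨x, hx⟩, mem_ball_self (hr _)⟩
    simp only [mem_iUnion] at this
    obtain ⟨i, hi, -⟩ := this
    exact ⟨i, hi⟩
  obtain ⟨s, hs⟩ := hT.exists_eq_range hTne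
  refine ⟨fun n => s n, fun n => r (s n), fun n => hr _, fun n => hsub _, fun x hx => ?_⟩
  have : x ∈ ⋃ i ∈ T, ball (i : ℂ) (r i) := by
    rw [hTU]
    exact mem_iUnion.2 ⟨⟨x, hx⟩, mem_ball_self (hr _)⟩
  simp only [mem_iUnion] at this
  obtain ⟨i, hi, hxi⟩ := this
  rw [hs] at hi
  obtain ⟨n, rfl⟩ := hi
  exact ⟨n, hxi⟩

/-- Poisson integrals pass to bounded pointwise limits. -/
lemma tendsto_poissonIntegral_of_bounded {F : ℕ → ℂ → ℝ} {u : ℂ → ℝ} {c w : ℂ} {R M : ℝ}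
    (hw : w ∈ ball c R) (hF : ∀ n, ContinuousOn (F n) (sphere c R))
    (hM : ∀ n, ∀ z ∈ sphere c R, |F n z| ≤ M)
    (hlim : ∀ z ∈ sphere c R, Tendsto (fun n => F n z) atTop (𝓝 (u z))) :
    Tendsto (fun n => poissonIntegral c R (F n) w) atTop (𝓝 (poissonIntegral c R u w)) := by
  have h0 : 0 < R := pos_of_mem_ball hw
  simp only [poissonIntegral, circleAverage_def]
  refine Tendsto.const_smul ?_ _
  have hmem : ∀ θ, circleMap c R θ ∈ sphere c R := circleMap_mem_sphere c h0.le
  have hP : Continuous fun θ => poissonKernel c w (circleMap c R θ) :=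
    (continuousOn_poissonKernel hw).comp_continuous (continuous_circleMap c R) hmem
  have hFc : ∀ n, Continuous fun θ => F n (circleMap c R θ) := fun n =>
    (hF n).comp_continuous (continuous_circleMap c R) hmem
  refine intervalIntegral.tendsto_integral_filter_of_dominated_convergence
    (fun θ => poissonKernel c w (circleMap c R θ) * M) ?_ ?_ ?_ ?_
  · exact Eventually.of_forall fun n => (hP.mul (hFc n)).aestronglyMeasurable
  · refine Eventually.of_forall fun n => Eventually.of_forall fun θ _ => ?_
    rw [Pi.smul_apply', smul_eq_mul, norm_mul, Real.norm_eq_abs, Real.norm_eq_abs,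
      abs_of_nonneg (poissonKernel_nonneg hw (hmem θ))]
    exact mul_le_mul_of_nonneg_left (hM n _ (hmem θ)) (poissonKernel_nonneg hw (hmem θ))
  · exact (hP.mul continuous_const).intervalIntegrable _ _
  · exact Eventually.of_forall fun θ _ => (hlim _ (hmem θ)).const_mul _

/-- The limit is not known to be continuous on the circle; measurability and the common bound
suffice for its Poisson integral to make sense. -/
lemma circleIntegrable_of_tendsto {F : ℕ → ℂ → ℝ} {u : ℂ → ℝ} {c : ℂ} {R M : ℝ} (h0 : 0 < R)
    (hF : ∀ n, ContinuousOn (F n) (sphere c R)) (hM : ∀ n, ∀ z ∈ sphere c R, |F n z| ≤ M)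
    (hlim : ∀ z ∈ sphere c R, Tendsto (fun n => F n z) atTop (𝓝 (u z))) :
    CircleIntegrable u c R := by
  have hmem : ∀ θ, circleMap c R θ ∈ sphere c R := circleMap_mem_sphere c h0.le
  have hFc : ∀ n, Continuous fun θ => F n (circleMap c R θ) := fun n =>
    (hF n).comp_continuous (continuous_circleMap c R) hmem
  have hmeas : Measurable fun θ => u (circleMap c R θ) :=
    measurable_of_tendsto_metrizable (fun n => (hFc n).measurable)
      (tendsto_pi_nhds.2 fun θ => hlim _ (hmem θ))
  refine (intervalIntegrable_const (c := M)).mono_fun hmeas.aestronglyMeasurable ?_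
  refine Eventually.of_forall fun θ => ?_
  rw [Real.norm_eq_abs]
  refine (le_of_tendsto (hlim _ (hmem θ)).abs (Eventually.of_forall fun n => hM n _ (hmem θ))).trans
    (le_abs_self M)

/-- A bounded pointwise limit of functions which agree with Poisson integrals on a disc is
harmonic there. -/
lemma harmonicOnNhd_ball_of_tendsto {F G : ℕ → ℂ → ℝ} {u : ℂ → ℝ} {c : ℂ} {R M : ℝ} (h0 : 0 < R)
    (hF : ∀ n, ContinuousOn (F n) (sphere c R)) (hM : ∀ n, ∀ z ∈ sphere c R, |F n z| ≤ M)
    (hlim : ∀ z ∈ sphere c R, Tendsto (fun n => F n z) atTop (𝓝 (u z)))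
    (hG : ∀ n, ∀ w ∈ ball c R, G n w = poissonIntegral c R (F n) w)
    (hGlim : ∀ w ∈ ball c R, Tendsto (fun n => G n w) atTop (𝓝 (u w))) :
    HarmonicOnNhd u (ball c R) := by
  -- Both sides of `hG` pass to the limit, so `u` is the Poisson integral of itself; no Harnack
  -- estimate is needed.
  have heq : ∀ w ∈ ball c R, u w = poissonIntegral c R u w := fun w hw => by
    refine tendsto_nhds_unique (hGlim w hw) ?_
    simp only [hG _ w hw]
    exact tendsto_poissonIntegral_of_bounded hw hF hM hlim
  intro w hw
  refine (harmonicAt_congr_nhds ?_).2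
    (harmonicOnNhd_poissonIntegral (circleIntegrable_of_tendsto h0 hF hM hlim) w hw)
  filter_upwards [isOpen_ball.mem_nhds hw] with v hv using heq v hv

/-- The sequence of functions obtained by successive Poisson modifications, every disc being used
infinitely often. -/
noncomputable def balayage (c : ℕ → ℂ) (R : ℕ → ℝ) (f : ℂ → ℝ) : ℕ → ℂ → ℝ
  | 0 => f
  | n + 1 => poissonModification (c n.unpair.1) (R n.unpair.1) (balayage c R f n)

/-- Each sweep raises the function, keeps it submean and preserves the boundary values, so the
maximum principle bounds the sequence and it converges pointwise. The limit is harmonic on every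
disc of the cover because that disc is used infinitely often. At the boundary the limit is squeezed
between `f` and the majorants given by barriers. -/
theorem exists_harmonicContOnCl_of_submean {U : Set ℂ} (hU : IsOpen U)
    (hb : Bornology.IsBounded U) (hbar : ∀ z ∈ frontier U, ∃ b, IsBarrier b U z) {f : ℂ → ℝ}
    (cf : ContinuousOn f (closure U)) (hf : IsLocallySubmean f U) :
    ∃ u, HarmonicContOnCl u U ∧ EqOn u f (frontier U) := by
  rcases U.eq_empty_or_nonempty with rfl | hne
  · exact ⟨0, ⟨fun x hx => hx.elim, by simp⟩, by simp⟩
  obtain ⟨c, R, hR, hcR, hcov⟩ := exists_seq_ball_cover hU hne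
  set F := balayage c R f with hFdef
  have hcl : ∀ n, closedBall (c n) (R n) ⊆ closure U := fun n => (hcR n).trans subset_closure
  have hFc : ∀ n, ContinuousOn (F n) (closure U) := by
    intro n
    induction n with
    | zero => exact cf
    | succ n ih => exact continuousOn_poissonModification (hR _) (hcl _) ih
  have hFs : ∀ n, IsLocallySubmean (F n) U := by
    intro n
    induction n with
    | zero => exact hf
    | succ n ih => exact ih.poissonModification (hR _) hU (hcR _) ((hFc n).mono subset_closure)
  have hFf : ∀ n, EqOn (F n) f (frontier U) := by
    intro n
    induction n with
    | zero => exact fun _ _ => rfl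
    | succ n ih =>
      intro x hx
      rw [← ih hx]
      refine poissonModification_of_notMem fun hn => ?_
      rw [hU.frontier_eq] at hx
      exact hx.2 (hcR _ (ball_subset_closedBall hn))
  have hmono : ∀ x, Monotone fun n => F n x := fun x => monotone_nat_of_le_succ fun n =>
    le_poissonModification (hR _) (hcR _) ((hFc n).mono subset_closure) (hFs n) x
  obtain ⟨M, hM⟩ := hb.isCompact_closure.exists_bound_of_continuousOn cf
  have hFM : ∀ n, ∀ x ∈ closure U, |F n x| ≤ M := fun n x hx => by
    refine abs_le.2 ⟨(abs_le.1 (hM x hx)).1.trans (hmono x (Nat.zero_le n)), ?_⟩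
    refine (hFs n).le_of_le_frontier hU hb (hFc n) (fun y hy => ?_) x hx
    rw [hFf n hy]
    exact (abs_le.1 (hM y (frontier_subset_closure hy))).2
  set u : ℂ → ℝ := fun x => ⨆ n, F n x with hu
  have hlim : ∀ x ∈ closure U, Tendsto (fun n => F n x) atTop (𝓝 (u x)) := fun x hx =>
    tendsto_atTop_ciSup (hmono x) ⟨M, by rintro _ ⟨n, rfl⟩; exact (abs_le.1 (hFM n x hx)).2⟩
  have hharm : HarmonicOnNhd u U := by
    intro x hx
    obtain ⟨k, hk⟩ := hcov x hx
    have hs : sphere (c k) (R k) ⊆ closure U := sphere_subset_closedBall.trans (hcl k)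
    -- The sweeps at times `Nat.pair k j` are exactly those using disc `k`. The functions just
    -- before and just after them are two subsequences with the same limit.
    have hsub : Tendsto (fun j => Nat.pair k j) atTop atTop :=
      tendsto_atTop_mono (fun j => Nat.right_le_pair k j) tendsto_id
    refine harmonicOnNhd_ball_of_tendsto (F := fun j => F (Nat.pair k j))
      (G := fun j => F (Nat.pair k j + 1)) (M := M) (hR k) (fun j => (hFc _).mono hs)
      (fun j z hz => hFM _ z (hs hz)) (fun z hz => (hlim z (hs hz)).comp hsub) ?_ ?_ x hk
    · intro j w hw
      have : F (Nat.pair k j + 1) = poissonModification (c k) (R k) (F (Nat.pair k j)) := by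
        change poissonModification _ _ _ = _
        rw [Nat.unpair_pair]
      rw [this, poissonModification_of_mem hw]
    · intro w hw
      exact (hlim w (hcl k (ball_subset_closedBall hw))).comp
        ((tendsto_add_atTop_nat 1).comp hsub)
  have hfu : ∀ x ∈ closure U, f x ≤ u x := fun x hx =>
    ge_of_tendsto (hlim x hx) (Eventually.of_forall fun n => hmono x (Nat.zero_le n))
  have hueq : EqOn u f (frontier U) := fun x hx => by
    refine tendsto_nhds_unique (hlim x (frontier_subset_closure hx)) ?_
    simp only [hFf _ hx]
    exact tendsto_const_nhds
  refine ⟨u, ⟨hharm, fun z hz => ?_⟩, hueq⟩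
  by_cases hzU : z ∈ U
  · exact (hharm z hzU).1.continuousAt.continuousWithinAt
  have hzf : z ∈ frontier U := by rw [hU.frontier_eq]; exact ⟨hz, hzU⟩
  obtain ⟨b, hb'⟩ := hbar z hzf
  rw [ContinuousWithinAt, hueq hzf]
  refine tendsto_order.2 ⟨fun a ha => ?_, fun a ha => ?_⟩
  · filter_upwards [(cf z hz).eventually (eventually_gt_nhds ha), self_mem_nhdsWithin] with x h1 h2
    exact h1.trans_le (hfu x h2)
  · obtain ⟨C, -, hC⟩ := hb'.exists_le hb hzf (cf.mono frontier_subset_closure)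
      (half_pos (sub_pos.2 ha))
    have hle : ∀ x ∈ closure U, u x ≤ f z + (a - f z) / 2 + C * b x := fun x hx =>
      le_of_tendsto (hlim x hx) (Eventually.of_forall fun n =>
        (hFs n).le_add_mul_barrier hb' hU hb (hFc n)
          (fun y hy => by rw [hFf n hy]; exact hC y hy) x hx)
    have hcont : ContinuousWithinAt (fun x => f z + (a - f z) / 2 + C * b x) (closure U) z :=
      continuousWithinAt_const.add (continuousWithinAt_const.mul (hb'.harmonic.2 z hz))
    have hlt : f z + (a - f z) / 2 + C * b z < a := by rw [hb'.apply_self]; linarith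
    filter_upwards [hcont.eventually (eventually_lt_nhds hlt), self_mem_nhdsWithin] with x h1 h2
    exact (hle x h2).trans_lt h1

end VEM

namespace VEM

open Filter Topology Metric Real InnerProductSpace

/-! ### The Dirichlet problem for continuous data -/

lemma abs_le_of_harmonicContOnCl {u : ℂ → ℝ} {U : Set ℂ} (hU : IsOpen U)
    (hb : Bornology.IsBounded U) (hu : HarmonicContOnCl u U) {M : ℝ}
    (h : ∀ x ∈ frontier U, |u x| ≤ M) : ∀ x ∈ closure U, |u x| ≤ M := fun x hx =>
  abs_le'.2 ⟨(IsLocallySubmean.of_harmonicOnNhd hU hu.1).le_of_le_frontier hU hb hu.2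
    (fun y hy => (abs_le'.1 (h y hy)).1) x hx,
    (IsLocallySubmean.of_harmonicOnNhd hU hu.neg.1).le_of_le_frontier hU hb hu.neg.2
    (fun y hy => (abs_le'.1 (h y hy)).2) x hx⟩

lemma harmonicContOnCl_of_tendstoUniformlyOn {F : ℕ → ℂ → ℝ} {u : ℂ → ℝ} {U : Set ℂ}
    (hU : IsOpen U) (hF : ∀ n, HarmonicContOnCl (F n) U)
    (hM : ∃ M, ∀ n, ∀ z ∈ closure U, |F n z| ≤ M)
    (h : TendstoUniformlyOn F u atTop (closure U)) : HarmonicContOnCl u U := by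
  refine ⟨fun x hx => ?_, h.continuousOn (Frequently.of_forall fun n => (hF n).2)⟩
  obtain ⟨r, h1, h2⟩ := ((eventually_closedBall_subset hU hx).and self_mem_nhdsWithin).exists
  have h2 : 0 < r := h2
  obtain ⟨M, hM⟩ := hM
  have hs : sphere x r ⊆ closure U := (sphere_subset_closedBall.trans h1).trans subset_closure
  refine harmonicOnNhd_ball_of_tendsto (F := F) (G := F) (M := M) h2 (fun n => (hF n).2.mono hs)
    (fun n z hz => hM n z (hs hz)) (fun z hz => h.tendsto_at (hs hz)) ?_ ?_ x (mem_ball_self h2)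
  · exact fun n w hw =>
      (poissonIntegral_eq_self ((hF n).mono (ball_subset_closedBall.trans h1)) hw).symm
  · exact fun w hw => h.tendsto_at (subset_closure (h1 (ball_subset_closedBall hw)))

/-- The restrictions to `S` of the differences of continuous submean functions on the plane. -/
def submeanDifferences (S : Set ℂ) : Set C(S, ℝ) :=
  {h | ∃ f g : ℂ → ℝ, Continuous f ∧ Continuous g ∧ IsLocallySubmean f univ ∧
    IsLocallySubmean g univ ∧ ∀ x : S, h x = f x - g x}

lemma IsLocallySubmean.sup {f g : ℂ → ℝ} {U : Set ℂ} (hU : IsOpen U) (hf : IsLocallySubmean f U)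
    (hg : IsLocallySubmean g U) (cf : ContinuousOn f U) (cg : ContinuousOn g U) :
    IsLocallySubmean (f ⊔ g) U := fun x hx => by
  filter_upwards [hf x hx, hg x hx, eventually_closedBall_subset hU hx, self_mem_nhdsWithin]
    with r h1 h2 h3 h4
  have i1 := circleIntegrable_of_closedBall_subset cf (le_of_lt h4) h3
  have i2 := circleIntegrable_of_closedBall_subset cg (le_of_lt h4) h3
  have i3 := circleIntegrable_of_closedBall_subset (cf.sup cg) (le_of_lt h4) h3
  exact sup_le (h1.trans (circleAverage_mono i1 i3 fun z _ => le_sup_left))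
    (h2.trans (circleAverage_mono i2 i3 fun z _ => le_sup_right))

/-- Sums and maxima of submean functions are submean, and $\max(f-g,f'-g')=\max(f+g',f'+g)-(g+g')$.
-/
lemma sup_mem_submeanDifferences {S : Set ℂ} {h k : C(S, ℝ)} (hh : h ∈ submeanDifferences S)
    (hk : k ∈ submeanDifferences S) : h ⊔ k ∈ submeanDifferences S := by
  obtain ⟨f, g, cf, cg, hf, hg, hfg⟩ := hh
  obtain ⟨f', g', cf', cg', hf', hg', hfg'⟩ := hk
  refine ⟨(f + g') ⊔ (f' + g), g + g', (cf.add cg').sup (cf'.add cg), cg.add cg', ?_, ?_, ?_⟩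
  · exact (hf.add isOpen_univ hg' cf.continuousOn cg'.continuousOn).sup isOpen_univ
      (hf'.add isOpen_univ hg cf'.continuousOn cg.continuousOn) (cf.add cg').continuousOn
      (cf'.add cg).continuousOn
  · exact hg.add isOpen_univ hg' cg.continuousOn cg'.continuousOn
  · intro x
    simp only [ContinuousMap.sup_apply, hfg, hfg', Pi.sup_apply, Pi.add_apply]
    rw [← max_sub_sub_right]
    congr 1 <;> ring

lemma neg_mem_submeanDifferences {S : Set ℂ} {h : C(S, ℝ)} (hh : h ∈ submeanDifferences S) :
    -h ∈ submeanDifferences S := by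
  obtain ⟨f, g, cf, cg, hf, hg, hfg⟩ := hh
  exact ⟨g, f, cg, cf, hg, hf, fun x => by simp [hfg]⟩

/-- The lattice form of the Stone–Weierstrass theorem: infima follow from suprema by negation, and
the harmonic functions $\operatorname{Re}(r+az)$ interpolate arbitrary values at two points. -/
lemma closure_submeanDifferences {S : Set ℂ} (hS : IsCompact S) :
    closure (submeanDifferences S) = ⊤ := by
  have : CompactSpace S := isCompact_iff_compactSpace.1 hS
  have hharm : ∀ (a : ℂ) (r : ℝ), HarmonicOnNhd (fun z : ℂ => (r + a * z).re) univ := fun a r z _ =>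
    (show Differentiable ℂ fun z : ℂ => r + a * z by fun_prop).analyticAt z |>.harmonicAt_re
  have hmem : ∀ (a : ℂ) (r : ℝ), (⟨fun z : S => (r + a * z).re, by fun_prop⟩ : C(S, ℝ)) ∈
      submeanDifferences S := fun a r =>
    ⟨fun z : ℂ => (r + a * z).re, 0, by fun_prop, by fun_prop,
      .of_harmonicOnNhd isOpen_univ (hharm a r),
      .of_harmonicOnNhd isOpen_univ (harmonicOnNhd_const 0), fun x => by simp⟩
  refine ContinuousMap.sublattice_closure_eq_top _ ⟨_, hmem 0 0⟩ ?_
    (fun f hf g hg => sup_mem_submeanDifferences hf hg) ?_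
  · intro f hf g hg
    have := neg_mem_submeanDifferences (sup_mem_submeanDifferences
      (neg_mem_submeanDifferences hf) (neg_mem_submeanDifferences hg))
    convert this using 1
    ext x
    simp [max_neg_neg]
  · intro v x y
    by_cases hxy : x = y
    · subst hxy
      exact ⟨_, hmem 0 (v x), by simp, by simp⟩
    · have hne : (y - x : ℂ) ≠ 0 := sub_ne_zero.2 fun h => hxy (Subtype.ext h.symm)
      set a : ℂ := (v y - v x : ℝ) / (y - x : ℂ)
      have ha : a * (y - x) = (v y - v x : ℝ) := div_mul_cancel₀ _ hne
      refine ⟨_, hmem a (v x - (a * x).re), by simp, ?_⟩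
      have := congrArg Complex.re ha
      simp at this ⊢
      linarith

/-- The datum is a uniform limit of differences of submean functions, for which the problem is
already solved. The maximum principle turns uniform closeness on the boundary into uniform closeness
on the closure, so the solutions form a Cauchy sequence. -/
theorem exists_harmonicContOnCl_of_continuousOn {U : Set ℂ} (hU : IsOpen U)
    (hb : Bornology.IsBounded U) (hbar : ∀ z ∈ frontier U, ∃ b, IsBarrier b U z) {g : ℂ → ℝ}
    (cg : ContinuousOn g (closure U)) : ∃ u, HarmonicContOnCl u U ∧ EqOn u g (frontier U) := by
  have hcpt := hb.isCompact_closure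
  have : CompactSpace (closure U) := isCompact_iff_compactSpace.1 hcpt
  have happ : ∀ n : ℕ, ∃ u, HarmonicContOnCl u U ∧
      ∀ x ∈ frontier U, |u x - g x| ≤ 1 / ((n : ℝ) + 1) := by
    intro n
    have hg : (⟨fun x : closure U => g x, cg.domRestrict⟩ : C(closure U, ℝ)) ∈
        closure (submeanDifferences (closure U)) := by
      rw [closure_submeanDifferences hcpt]; trivial
    obtain ⟨h, ⟨f₁, f₂, c₁, c₂, h₁, h₂, hf⟩, hdist⟩ :=
      Metric.mem_closure_iff.1 hg (1 / ((n : ℝ) + 1)) (by positivity)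
    obtain ⟨u₁, hu₁, he₁⟩ := exists_harmonicContOnCl_of_submean hU hb hbar c₁.continuousOn
      (h₁.mono (subset_univ U))
    obtain ⟨u₂, hu₂, he₂⟩ := exists_harmonicContOnCl_of_submean hU hb hbar c₂.continuousOn
      (h₂.mono (subset_univ U))
    refine ⟨u₁ - u₂, hu₁.sub hu₂, fun x hx => ?_⟩
    have hxc := frontier_subset_closure hx
    have h3 := (ContinuousMap.dist_apply_le_dist ⟨x, hxc⟩).trans hdist.le
    rw [Real.dist_eq, hf, abs_sub_comm] at h3
    rw [Pi.sub_apply, he₁ hx, he₂ hx]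
    exact h3
  choose u hu hug using happ
  have hcauchy : ∀ n m, ∀ x ∈ closure U,
      |u n x - u m x| ≤ 1 / ((n : ℝ) + 1) + 1 / ((m : ℝ) + 1) := fun n m =>
    abs_le_of_harmonicContOnCl hU hb ((hu n).sub (hu m)) fun x hx => by
      have h1 := hug n x hx
      have h2 := hug m x hx
      rw [abs_sub_comm] at h2
      calc |u n x - u m x| = |(u n x - g x) + (g x - u m x)| := by ring_nf
        _ ≤ _ := (abs_add_le _ _).trans (add_le_add h1 h2)
  have hucs : UniformCauchySeqOn u atTop (closure U) := by
    rw [Metric.uniformCauchySeqOn_iff]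
    intro ε hε
    obtain ⟨N, hN⟩ := exists_nat_one_div_lt (half_pos hε)
    refine ⟨N, fun m hm n hn x hx => ?_⟩
    have h1 := Nat.one_div_le_one_div (α := ℝ) hm
    have h2 := Nat.one_div_le_one_div (α := ℝ) hn
    rw [Real.dist_eq]
    linarith [hcauchy m n x hx]
  have hlim : ∀ x, ∃ l, x ∈ closure U → Tendsto (fun n => u n x) atTop (𝓝 l) := fun x => by
    by_cases hx : x ∈ closure U
    · obtain ⟨l, hl⟩ := cauchySeq_tendsto_of_complete (hucs.cauchySeq hx)
      exact ⟨l, fun _ => hl⟩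
    · exact ⟨0, fun h => (hx h).elim⟩
  choose v hv using hlim
  have hunif := hucs.tendstoUniformlyOn_of_tendsto fun x hx => hv x hx
  obtain ⟨M, hM⟩ := hcpt.exists_bound_of_continuousOn (hu 0).2
  -- `M` bounds `u 0`, and `u n` differs from it by at most $1/(n+1)+1\le 2$.
  refine ⟨v, harmonicContOnCl_of_tendstoUniformlyOn hU hu ⟨M + 2, fun n z hz => ?_⟩ hunif, ?_⟩
  · have h1 := hcauchy n 0 z hz
    have h2 := hM z hz
    have h3 : 1 / ((n : ℝ) + 1) ≤ 1 := by
      rw [div_le_one (by positivity)]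
      linarith [(Nat.cast_nonneg n : (0 : ℝ) ≤ n)]
    have h4 := abs_add_le (u n z - u 0 z) (u 0 z)
    rw [Real.norm_eq_abs] at h2
    simp at h1 h4 h3
    linarith
  · intro x hx
    refine tendsto_nhds_unique (hv x (frontier_subset_closure hx)) ?_
    rw [tendsto_iff_norm_sub_tendsto_zero]
    exact squeeze_zero (fun _ => norm_nonneg _) (fun n => hug n x hx)
      tendsto_one_div_add_atTop_nhds_zero_nat

end VEM

namespace VEM

open Filter Topology Metric Real InnerProductSpace

/-! ### Barriers at the end of a segment -/

/-- The real part of `√((x - z') / (x - z))`, multiplied by `‖x - z‖`. -/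
noncomputable def segmentBarrierAux (z z' x : ℂ) : ℝ :=
  √((‖x - z'‖ * ‖x - z‖ + ((x - z') * (starRingEnd ℂ) (x - z)).re) / 2)

/-- The real part of `1 / (1 + √((x - z') / (x - z)))`, written so as to be continuous across the
segment from `z` to `z'`. -/
noncomputable def segmentBarrier (z z' x : ℂ) : ℝ :=
  (‖x - z‖ + segmentBarrierAux z z' x) /
    (‖x - z‖ + 2 * segmentBarrierAux z z' x + ‖x - z'‖)

lemma segmentBarrier_denom_pos {z z' : ℂ} (h : z ≠ z') (x : ℂ) :
    0 < ‖x - z‖ + 2 * segmentBarrierAux z z' x + ‖x - z'‖ := by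
  have h1 : 0 < ‖z - z'‖ := norm_pos_iff.2 (sub_ne_zero.2 h)
  have h2 : ‖z - z'‖ ≤ ‖x - z‖ + ‖x - z'‖ := by
    have := norm_sub_le (x - z') (x - z)
    rw [sub_sub_sub_cancel_left] at this
    linarith
  have h3 : 0 ≤ segmentBarrierAux z z' x := Real.sqrt_nonneg _
  linarith

lemma continuous_segmentBarrier {z z' : ℂ} (h : z ≠ z') : Continuous (segmentBarrier z z') := by
  have h1 : Continuous (segmentBarrierAux z z') := by unfold segmentBarrierAux; fun_prop
  unfold segmentBarrier
  exact Continuous.div (by fun_prop) (by fun_prop) fun x => (segmentBarrier_denom_pos h x).ne'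

lemma segmentBarrier_self (z z' : ℂ) : segmentBarrier z z' z = 0 := by
  simp [segmentBarrier, segmentBarrierAux]

lemma segmentBarrier_pos {z z' x : ℂ} (h : z ≠ z') (hx : x ≠ z) : 0 < segmentBarrier z z' x := by
  have h3 : 0 ≤ segmentBarrierAux z z' x := Real.sqrt_nonneg _
  have h4 : 0 < ‖x - z‖ := norm_pos_iff.2 (sub_ne_zero.2 hx)
  exact div_pos (by linarith) (segmentBarrier_denom_pos h x)

/-- If the quotient were a real $q\le 0$, then $x-z'=q(x-z)$ would exhibit `x` as the convex
combination of `z` and `z'` with weights $-q/(1-q)$ and $1/(1-q)$. -/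
lemma mem_slitPlane_of_notMem_segment {z z' x : ℂ} (hx : x ∉ segment ℝ z z') :
    (x - z') / (x - z) ∈ Complex.slitPlane := by
  by_contra hn
  have hxz : x - z ≠ 0 := fun h => hx (by
    rw [sub_eq_zero.1 h]; exact left_mem_segment ℝ z z')
  rw [Complex.mem_slitPlane_iff_not_le_zero, not_not] at hn
  set q := (x - z') / (x - z) with hq
  have him : q.im = 0 := (Complex.le_def.1 hn).2
  have hre : q.re ≤ 0 := (Complex.le_def.1 hn).1
  have hqr : q = (q.re : ℂ) := Complex.ext rfl (by simp [him])
  have heq : x - z' = q.re * (x - z) := by rw [← hqr, hq, div_mul_cancel₀ _ hxz]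
  apply hx
  have hpos : (0 : ℝ) < 1 - q.re := by linarith
  have hposC : (1 - q.re : ℂ) ≠ 0 := by exact_mod_cast hpos.ne'
  refine ⟨-q.re / (1 - q.re), 1 / (1 - q.re), div_nonneg (by linarith) hpos.le, by positivity,
    by field_simp; ring, ?_⟩
  simp only [Complex.real_smul]
  push_cast
  field_simp
  linear_combination -heq

/-- With $s=\sqrt q$ and $\operatorname{Re}s\ge 0$ one has
$\operatorname{Re}\frac1{1+s}=\frac{1+\operatorname{Re}s}{1+2\operatorname{Re}s+|s|^2}$.
Substituting $|s|^2=|x-z'|/|x-z|$ and $(\operatorname{Re}s)^2=(|q|+\operatorname{Re}q)/2$ and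
clearing $|x-z|$ gives the explicit formula. Across the cut $s$ jumps to its conjugate, which does
not affect the real part; at `z` the root blows up, hence the value 0. -/
lemma segmentBarrier_eq_re {z z' x : ℂ} (hx : x ∉ segment ℝ z z') :
    segmentBarrier z z' x = (1 / (1 + ((x - z') / (x - z)) ^ (1 / 2 : ℂ))).re ∧
      1 + ((x - z') / (x - z)) ^ (1 / 2 : ℂ) ≠ 0 := by
  have hxz : x - z ≠ 0 := fun h => hx (by
    rw [sub_eq_zero.1 h]; exact left_mem_segment ℝ z z')
  have hxz' : x - z' ≠ 0 := fun h => hx (by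
    rw [sub_eq_zero.1 h]; exact right_mem_segment ℝ z z')
  set q := (x - z') / (x - z) with hq
  have hq0 : q ≠ 0 := div_ne_zero hxz' hxz
  set s := q ^ (1 / 2 : ℂ) with hs
  have hss : s * s = q := by
    rw [hs, ← Complex.cpow_add _ _ hq0]; norm_num
  have hsre : 0 ≤ s.re := by
    rw [hs, Complex.cpow_def_of_ne_zero hq0, Complex.exp_re]
    refine mul_nonneg (exp_pos _).le (Real.cos_nonneg_of_mem_Icc ?_)
    have h1 := Complex.neg_pi_lt_arg q
    have h2 := Complex.arg_le_pi q
    have : (Complex.log q * (1 / 2)).im = q.arg / 2 := by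
      rw [show (1 / 2 : ℂ) = ((1 / 2 : ℝ) : ℂ) by push_cast; rfl, Complex.im_mul_ofReal,
        Complex.log_im]
      ring
    rw [this]
    constructor <;> linarith
  have hne : 1 + s ≠ 0 := fun h => by
    have := congrArg Complex.re h
    simp at this
    linarith
  refine ⟨?_, hne⟩
  have hr : 0 < ‖x - z‖ := norm_pos_iff.2 hxz
  have hnorm : ‖x - z'‖ = ‖x - z‖ * Complex.normSq s := by
    rw [Complex.normSq_eq_norm_sq, sq, ← norm_mul, hss, hq, ← norm_mul, mul_div_cancel₀ _ hxz]
  have hprod : ((x - z') * (starRingEnd ℂ) (x - z)).re = ‖x - z‖ ^ 2 * (s * s).re := by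
    rw [hss, hq]
    have : (x - z') * (starRingEnd ℂ) (x - z) = (‖x - z‖ ^ 2 : ℝ) * ((x - z') / (x - z)) := by
      rw [← Complex.normSq_eq_norm_sq, Complex.normSq_eq_conj_mul_self]
      field_simp
    rw [this, Complex.re_ofReal_mul]
  have haux : segmentBarrierAux z z' x = ‖x - z‖ * s.re := by
    rw [segmentBarrierAux, hprod, hnorm, Complex.normSq_apply, Complex.mul_re]
    rw [show (‖x - z‖ * (s.re * s.re + s.im * s.im) * ‖x - z‖ +
      ‖x - z‖ ^ 2 * (s.re * s.re - s.im * s.im)) / 2 = (‖x - z‖ * s.re) ^ 2 by ring]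
    exact Real.sqrt_sq (by positivity)
  have hD : Complex.normSq (1 + s) = 1 + 2 * s.re + Complex.normSq s := by
    simp only [Complex.normSq_apply, Complex.add_re, Complex.one_re, Complex.add_im, Complex.one_im]
    ring
  rw [one_div, Complex.inv_re, hD, segmentBarrier, haux, hnorm, Complex.add_re, Complex.one_re]
  have : 0 < 1 + 2 * s.re + Complex.normSq s := by
    have := Complex.normSq_nonneg s
    linarith
  rw [show ‖x - z‖ + ‖x - z‖ * s.re = ‖x - z‖ * (1 + s.re) by ring,
    show ‖x - z‖ + 2 * (‖x - z‖ * s.re) + ‖x - z‖ * Complex.normSq s =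
      ‖x - z‖ * (1 + 2 * s.re + Complex.normSq s) by ring]
  exact mul_div_mul_left _ _ hr.ne'

lemma harmonicAt_segmentBarrier {z z' x : ℂ} (hx : x ∉ segment ℝ z z') :
    HarmonicAt (segmentBarrier z z') x := by
  have hcl : IsClosed (segment ℝ z z') := by
    rw [segment_eq_image]
    exact (isCompact_Icc.image (by fun_prop)).isClosed
  have hxz : x - z ≠ 0 := fun h => hx (by
    rw [sub_eq_zero.1 h]; exact left_mem_segment ℝ z z')
  have han : AnalyticAt ℂ (fun x => 1 / (1 + ((x - z') / (x - z)) ^ (1 / 2 : ℂ))) x := by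
    refine analyticAt_const.div (analyticAt_const.add (AnalyticAt.cpow ?_ analyticAt_const
      (mem_slitPlane_of_notMem_segment hx))) (segmentBarrier_eq_re hx).2
    exact AnalyticAt.div (by fun_prop) (by fun_prop) hxz
  refine (harmonicAt_congr_nhds ?_).2 han.harmonicAt_re
  filter_upwards [hcl.isOpen_compl.mem_nhds hx] with y hy using (segmentBarrier_eq_re hy).1

lemma isBarrier_segmentBarrier {z z' : ℂ} {U : Set ℂ} (h : z ≠ z')
    (hU : Disjoint (segment ℝ z z') U) : IsBarrier (segmentBarrier z z') U z where
  harmonic := ⟨fun _ hx => harmonicAt_segmentBarrier fun hs => hU.le_bot ⟨hs, hx⟩,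
    (continuous_segmentBarrier h).continuousOn⟩
  apply_self := segmentBarrier_self z z'
  pos _ _ hx := segmentBarrier_pos h hx

/-- The Dirichlet problem is solvable in bounded open sets of the plane such that every boundary
point is an end point of a nondegenerate segment outside the set. -/
theorem exists_harmonicContOnCl_of_segments {U : Set ℂ} (hU : IsOpen U)
    (hb : Bornology.IsBounded U)
    (hseg : ∀ z ∈ frontier U, ∃ z', z ≠ z' ∧ Disjoint (segment ℝ z z') U) {g : ℂ → ℝ}
    (cg : ContinuousOn g (frontier U)) : ∃ u, HarmonicContOnCl u U ∧ EqOn u g (frontier U) := by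
  -- Tietze extension of the boundary datum to the whole plane.
  obtain ⟨G, hG⟩ := ContinuousMap.exists_restrict_eq (Y := ℝ) (isClosed_frontier (s := U))
    ⟨_, cg.domRestrict⟩
  have hGg : EqOn G g (frontier U) := fun x hx => by
    have := DFunLike.congr_fun hG ⟨x, hx⟩
    simpa using this
  obtain ⟨u, hu, he⟩ := exists_harmonicContOnCl_of_continuousOn hU hb (fun z hz => by
    obtain ⟨z', hne, hd⟩ := hseg z hz
    exact ⟨_, isBarrier_segmentBarrier hne hd⟩) G.continuous.continuousOn
  exact ⟨u, hu, he.trans hGg⟩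

end VEM

namespace VEM

open Filter Topology Metric Real InnerProductSpace Laplacian

/-! ### The Laplacian on the plane -/

section Laplacian

variable {E F : Type*} [NormedAddCommGroup E] [InnerProductSpace ℝ E] [FiniteDimensional ℝ E]
  [NormedAddCommGroup F] [InnerProductSpace ℝ F] [FiniteDimensional ℝ F]

lemma laplacian_comp_linearIsometryEquiv (e : E ≃ₗᵢ[ℝ] F) (f : F → ℝ) (x : E) :
    laplacian (f ∘ e) x = laplacian f (e x) := by
  rw [laplacian_eq_iteratedFDeriv_orthonormalBasis (f ∘ e) (stdOrthonormalBasis ℝ E),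
    laplacian_eq_iteratedFDeriv_orthonormalBasis f ((stdOrthonormalBasis ℝ E).map e)]
  have h := e.toContinuousLinearEquiv.iteratedFDerivWithin_comp_right f uniqueDiffOn_univ
    (mem_univ (e x)) 2
  simp only [preimage_univ, iteratedFDerivWithin_univ] at h
  refine Finset.sum_congr rfl fun i _ => ?_
  have h' : iteratedFDeriv ℝ 2 (f ∘ e) x = _ := h
  rw [h', ContinuousMultilinearMap.compContinuousLinearMap_apply]
  congr 1
  ext j
  fin_cases j <;> simp

lemma laplacian_comp_sub_const (f : E → ℝ) (a x : E) :
    laplacian (fun y => f (y - a)) x = laplacian f (x - a) := by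
  rw [laplacian_eq_iteratedFDeriv_stdOrthonormalBasis, laplacian_eq_iteratedFDeriv_stdOrthonormalBasis]
  simp only [iteratedFDeriv_comp_sub]

lemma laplacian_comp_const_sub (f : E → ℝ) (a x : E) :
    laplacian (fun y => f (a - y)) x = laplacian f (a - x) := by
  have h1 := laplacian_comp_sub_const (f ∘ LinearIsometryEquiv.neg ℝ) a x
  rw [laplacian_comp_linearIsometryEquiv] at h1
  simpa [Function.comp_def] using h1

lemma harmonicAt_comp_linearIsometryEquiv (e : E ≃ₗᵢ[ℝ] F) {f : F → ℝ} {x : E}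
    (h : HarmonicAt f (e x)) : HarmonicAt (f ∘ e) x := by
  refine ⟨h.1.comp x e.contDiff.contDiffAt, ?_⟩
  filter_upwards [e.continuous.continuousAt.eventually h.2] with y hy
  rw [laplacian_comp_linearIsometryEquiv]
  exact hy

lemma laplacian_eq_sum_fderiv_fderiv {ι : Type*} [Fintype ι] (b : OrthonormalBasis ι ℝ E)
    {f : E → ℝ} {x : E} (hf : ContDiffAt ℝ 2 f x) :
    laplacian f x = ∑ i, fderiv ℝ (fun y => fderiv ℝ f y (b i)) x (b i) := by
  rw [laplacian_eq_iteratedFDeriv_orthonormalBasis f b]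
  refine Finset.sum_congr rfl fun i _ => ?_
  have hd : DifferentiableAt ℝ (fderiv ℝ f) x :=
    (hf.fderiv_right (m := 1) (by norm_num)).differentiableAt one_ne_zero
  rw [iteratedFDeriv_two_apply, fderiv_clm_apply hd (differentiableAt_const _)]
  simp

lemma continuous_laplacian {f : E → ℝ} (hf : ContDiff ℝ ∞ f) : Continuous (laplacian f) := by
  rw [laplacian_eq_iteratedFDeriv_stdOrthonormalBasis]
  have : Continuous (iteratedFDeriv ℝ 2 f) :=
    (contDiff_infty.1 hf 2).continuous_iteratedFDeriv (m := 2) le_rfl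
  fun_prop

lemma laplacian_eq_zero_of_notMem_tsupport {f : E → ℝ} {x : E} (hx : x ∉ tsupport f) :
    laplacian f x = 0 := by
  have : f =ᶠ[𝓝 x] fun _ => (0 : ℝ) := notMem_tsupport_iff_eventuallyEq.1 hx
  rw [(laplacian_congr_nhds this).eq_of_nhds]
  simp

end Laplacian

/-- The plane is isometric to the complex numbers. -/
noncomputable def planeToComplex : Plane ≃ₗᵢ[ℝ] ℂ := Complex.orthonormalBasisOneI.repr.symm

lemma image_planeToComplex_closure (U : Set Plane) :
    closure (planeToComplex '' U) = planeToComplex '' closure U :=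
  (planeToComplex.toHomeomorph.image_closure U).symm

lemma image_planeToComplex_frontier (U : Set Plane) :
    frontier (planeToComplex '' U) = planeToComplex '' frontier U :=
  (planeToComplex.toHomeomorph.image_frontier U).symm

lemma isOpen_image_planeToComplex {U : Set Plane} (hU : IsOpen U) : IsOpen (planeToComplex '' U) :=
  planeToComplex.toHomeomorph.isOpenMap U hU

lemma isBounded_image_planeToComplex {U : Set Plane} (hU : Bornology.IsBounded U) :
    Bornology.IsBounded (planeToComplex '' U) :=
  planeToComplex.lipschitz.isBounded_image hU

lemma harmonicContOnCl_comp_symm {h : Plane → ℝ} {U : Set Plane} (hh : HarmonicContOnCl h U) :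
    HarmonicContOnCl (h ∘ planeToComplex.symm) (planeToComplex '' U) := by
  constructor
  · rintro _ ⟨x, hx, rfl⟩
    exact harmonicAt_comp_linearIsometryEquiv _ (by simpa using hh.1 x hx)
  · rw [image_planeToComplex_closure]
    refine hh.2.comp planeToComplex.symm.continuous.continuousOn ?_
    rintro _ ⟨x, hx, rfl⟩
    simpa using hx

lemma HarmonicContOnCl.plane_le_of_le_frontier {h : Plane → ℝ} {U : Set Plane} (hU : IsOpen U)
    (hb : Bornology.IsBounded U) (hh : HarmonicContOnCl h U) {M : ℝ}
    (hM : ∀ x ∈ frontier U, h x ≤ M) : ∀ x ∈ closure U, h x ≤ M := by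
  intro x hx
  have hc := harmonicContOnCl_comp_symm hh
  have hUo := isOpen_image_planeToComplex hU
  have := (IsLocallySubmean.of_harmonicOnNhd hUo hc.1).le_of_le_frontier hUo
    (isBounded_image_planeToComplex hb) hc.2 (M := M) (by
      rw [image_planeToComplex_frontier]
      rintro _ ⟨y, hy, rfl⟩
      simpa using hM y hy) (planeToComplex x)
      (by rw [image_planeToComplex_closure]; exact mem_image_of_mem _ hx)
  simpa using this

/-- The Dirichlet problem in the plane. -/
theorem exists_plane_harmonicContOnCl {U : Set Plane} (hU : IsOpen U) (hb : Bornology.IsBounded U)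
    (hseg : ∀ z ∈ frontier U, ∃ z', z ≠ z' ∧ Disjoint (segment ℝ z z') U) {g : Plane → ℝ}
    (cg : ContinuousOn g (frontier U)) :
    ∃ u, HarmonicContOnCl u U ∧ (∀ x ∈ U, ContDiffAt ℝ ∞ u x) ∧ EqOn u g (frontier U) := by
  obtain ⟨u, hu, he⟩ := exists_harmonicContOnCl_of_segments (g := g ∘ planeToComplex.symm)
    (isOpen_image_planeToComplex hU) (isBounded_image_planeToComplex hb) (by
      rw [image_planeToComplex_frontier]
      rintro _ ⟨z, hz, rfl⟩
      obtain ⟨z', hne, hd⟩ := hseg z hz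
      refine ⟨planeToComplex z', planeToComplex.injective.ne hne, ?_⟩
      have : segment ℝ (planeToComplex z) (planeToComplex z') = planeToComplex '' segment ℝ z z' :=
        (image_segment ℝ planeToComplex.toLinearEquiv.toLinearMap.toAffineMap z z').symm
      rw [this]
      exact (disjoint_image_iff planeToComplex.injective).2 hd) (by
      rw [image_planeToComplex_frontier]
      refine cg.comp planeToComplex.symm.continuous.continuousOn ?_
      rintro _ ⟨x, hx, rfl⟩
      simpa using hx)
  rw [image_planeToComplex_frontier] at he
  refine ⟨u ∘ planeToComplex, ⟨fun x hx => harmonicAt_comp_linearIsometryEquiv _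
    (hu.1 _ (mem_image_of_mem _ hx)), hu.2.comp planeToComplex.continuous.continuousOn ?_⟩,
    fun x hx => ?_, fun x hx => ?_⟩
  · intro x hx
    rw [image_planeToComplex_closure]
    exact mem_image_of_mem _ hx
  · exact (HarmonicAt.analyticAt (hu.1 _ (mem_image_of_mem _ hx))).contDiffAt.comp x
      planeToComplex.contDiff.contDiffAt
  · simpa using he (mem_image_of_mem _ hx)

/-! ### Weak Laplacians -/

lemma integrableOn_of_continuousOn_closure {f : Plane → ℝ} {K : Set Plane}
    (hb : Bornology.IsBounded K) (hf : ContinuousOn f (closure K)) : IntegrableOn f K :=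
  (hf.integrableOn_compact hb.isCompact_closure).mono_set subset_closure

lemma integrableOn_mul_of_continuousOn_closure {f g : Plane → ℝ} {K : Set Plane}
    (hb : Bornology.IsBounded K) (hf : ContinuousOn f (closure K))
    (hg : ContinuousOn g (closure K)) : IntegrableOn (fun x => f x * g x) K :=
  integrableOn_of_continuousOn_closure hb (hf.mul hg)

lemma HasWeakLaplacian.sub {u v f g : Plane → ℝ} {K : Set Plane} (hb : Bornology.IsBounded K)
    (hu : HasWeakLaplacian u f K) (hv : HasWeakLaplacian v g K) (cu : ContinuousOn u (closure K))
    (cv : ContinuousOn v (closure K)) (cf : ContinuousOn f (closure K))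
    (cg : ContinuousOn g (closure K)) :
    HasWeakLaplacian (fun x => u x - v x) (fun x => f x - g x) K := by
  intro η h1 h2 h3
  have cl := (continuous_laplacian h1).continuousOn (s := closure K)
  have cη := h1.continuous.continuousOn (s := closure K)
  simp only [sub_mul]
  rw [integral_sub (integrableOn_mul_of_continuousOn_closure hb cu cl)
      (integrableOn_mul_of_continuousOn_closure hb cv cl),
    integral_sub (integrableOn_mul_of_continuousOn_closure hb cf cη)
      (integrableOn_mul_of_continuousOn_closure hb cg cη), hu η h1 h2 h3, hv η h1 h2 h3]

lemma HasWeakLaplacian.sum {ι : Type*} {s : Finset ι} {u f : ι → Plane → ℝ} {K : Set Plane}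
    (hb : Bornology.IsBounded K) (hu : ∀ i ∈ s, HasWeakLaplacian (u i) (f i) K)
    (cu : ∀ i ∈ s, ContinuousOn (u i) (closure K)) (cf : ∀ i ∈ s, ContinuousOn (f i) (closure K)) :
    HasWeakLaplacian (fun x => ∑ i ∈ s, u i x) (fun x => ∑ i ∈ s, f i x) K := by
  intro η h1 h2 h3
  have cl := (continuous_laplacian h1).continuousOn (s := closure K)
  have cη := h1.continuous.continuousOn (s := closure K)
  simp only [Finset.sum_mul]
  rw [integral_finsetSum _ fun i hi => integrableOn_mul_of_continuousOn_closure hb (cu i hi) cl,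
    integral_finsetSum _ fun i hi => integrableOn_mul_of_continuousOn_closure hb (cf i hi) cη]
  exact Finset.sum_congr rfl fun i hi => hu i hi η h1 h2 h3

lemma exists_contDiff_cutoff {C K : Set Plane} (hC : IsCompact C) (hK : IsOpen K) (h : C ⊆ K) :
    ∃ χ : Plane → ℝ, ContDiff ℝ ∞ χ ∧ HasCompactSupport χ ∧ tsupport χ ⊆ K ∧
      ∀ x ∈ C, χ =ᶠ[𝓝 x] 1 := by
  obtain ⟨L, hL, hCL, hLK⟩ := exists_compact_between hC hK h
  obtain ⟨f, h1, h2, -⟩ := exists_contMDiffMap_one_nhds_of_subset_interior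
    (modelWithCornersSelf ℝ Plane) (n := ⊤) hC.isClosed hCL
  have hts : tsupport f ⊆ L := closure_minimal (fun x hx => by
    by_contra hn
    exact hx (h2 x hn)) hL.isClosed
  exact ⟨f, f.contMDiff.contDiff, hL.of_isClosed_subset (isClosed_tsupport _) hts, hts.trans hLK,
    fun x hx => eventually_nhdsSet_iff_forall.1 h1 x hx⟩

lemma setIntegral_eq_integral_of_tsupport_subset {f : Plane → ℝ} {η : Plane → ℝ} {K : Set Plane}
    (h : ∀ x ∉ tsupport η, f x = 0) (hK : tsupport η ⊆ K) : ∫ x in K, f x = ∫ x, f x :=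
  setIntegral_eq_integral_of_forall_compl_eq_zero fun x hx => h x fun hn => hx (hK hn)

/-- Only interior smoothness of `v` is available. A cutoff equal to 1 near the support of the test
function turns `v` into a Schwartz function, and the Laplacian is symmetric on those. -/
lemma hasWeakLaplacian_of_contDiffAt {v g : Plane → ℝ} {K : Set Plane} (hK : IsOpen K)
    (hv : ∀ x ∈ K, ContDiffAt ℝ ∞ v x) (hg : ∀ x ∈ K, laplacian v x = g x) :
    HasWeakLaplacian v g K := by
  intro η h1 h2 h3
  obtain ⟨χ, c1, c2, c3, c4⟩ := exists_contDiff_cutoff h2.isCompact hK h3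
  set w : Plane → ℝ := fun x => χ x * v x with hw
  have hwsupp : HasCompactSupport w := c2.mul_right
  have hwd : ContDiff ℝ ∞ w := by
    rw [contDiff_iff_contDiffAt]
    intro x
    by_cases hx : x ∈ K
    · exact c1.contDiffAt.mul (hv x hx)
    · have : w =ᶠ[𝓝 x] fun _ => 0 := by
        filter_upwards [notMem_tsupport_iff_eventuallyEq.1 fun h => hx (c3 h)] with y hy
        simp only [hw, hy, Pi.zero_apply, zero_mul]
      exact contDiffAt_const.congr_of_eventuallyEq this
  have hwv : ∀ x ∈ tsupport η, w =ᶠ[𝓝 x] v := fun x hx => by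
    filter_upwards [c4 x hx] with y hy
    simp [hw, hy]
  have key := SchwartzMap.integral_mul_laplacian_right_eq_left (μ := (volume : Measure Plane))
    (hwsupp.toSchwartzMap hwd) (h2.toSchwartzMap h1)
  simp only [SchwartzMap.laplacian_apply] at key
  have key : ∫ x, w x * laplacian η x = ∫ x, laplacian w x * η x := key
  have e1 : ∀ x, v x * laplacian η x = w x * laplacian η x := fun x => by
    by_cases hx : x ∈ tsupport η
    · rw [(hwv x hx).eq_of_nhds]
    · simp [laplacian_eq_zero_of_notMem_tsupport hx]
  have e2 : ∀ x ∈ K, g x * η x = laplacian w x * η x := fun x hx => by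
    by_cases hx' : x ∈ tsupport η
    · rw [(laplacian_congr_nhds (hwv x hx')).eq_of_nhds, hg x hx]
    · simp [image_eq_zero_of_notMem_tsupport hx']
  simp only [e1]
  rw [setIntegral_congr_fun hK.measurableSet e2,
    setIntegral_eq_integral_of_tsupport_subset (η := η)
      (fun x hx => by simp [laplacian_eq_zero_of_notMem_tsupport hx]) h3,
    setIntegral_eq_integral_of_tsupport_subset (η := η)
      (fun x hx => by simp [image_eq_zero_of_notMem_tsupport hx]) h3, key]

end VEM

namespace VEM

open Filter Topology Metric Real InnerProductSpace Laplacian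

/-! ### Mollification and the maximum principle for weakly harmonic functions -/

open scoped Convolution in
/-- The convolution of `g` with the kernel `φ`. -/
noncomputable def mollify (φ g : Plane → ℝ) : Plane → ℝ :=
  g ⋆[(ContinuousLinearMap.lsmul ℝ ℝ).flip, volume] φ

lemma mollify_apply (φ g : Plane → ℝ) (x : Plane) : mollify φ g x = ∫ t, φ (x - t) * g t := by
  simp [mollify, convolution_def]

lemma contDiff_mollify {φ g : Plane → ℝ} (hφ : ContDiff ℝ ∞ φ) (hc : HasCompactSupport φ)
    (hg : LocallyIntegrable g) : ContDiff ℝ ∞ (mollify φ g) :=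
  hc.contDiff_convolution_right _ hg hφ

lemma fderiv_mollify_apply {φ g : Plane → ℝ} (hφ : ContDiff ℝ ∞ φ) (hc : HasCompactSupport φ)
    (hg : LocallyIntegrable g) (e x : Plane) :
    fderiv ℝ (mollify φ g) x e = mollify (fun y => fderiv ℝ φ y e) g x := by
  have h1 : ContDiff ℝ 1 φ := hφ.of_le (by exact_mod_cast le_top)
  rw [mollify, (hc.hasFDerivAt_convolution_right _ hg h1 x).fderiv,
    convolution_precompR_apply _ hg (hc.fderiv ℝ) (h1.continuous_fderiv one_ne_zero)]
  rfl

lemma contDiff_fderiv_apply {φ : Plane → ℝ} (hφ : ContDiff ℝ ∞ φ) (e : Plane) :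
    ContDiff ℝ ∞ fun y => fderiv ℝ φ y e :=
  (hφ.fderiv_right (m := ∞) (by simp)).clm_apply contDiff_const

lemma integrable_mollify_integrand {φ g : Plane → ℝ} (hφ : Continuous φ) (hc : HasCompactSupport φ)
    (hg : LocallyIntegrable g) (x : Plane) : Integrable fun t => φ (x - t) * g t := by
  simpa [ConvolutionExistsAt] using
    hc.convolutionExists_right (ContinuousLinearMap.lsmul ℝ ℝ).flip hg hφ x

lemma laplacian_mollify {φ g : Plane → ℝ} (hφ : ContDiff ℝ ∞ φ) (hc : HasCompactSupport φ)
    (hg : LocallyIntegrable g) (x : Plane) :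
    laplacian (mollify φ g) x = ∫ t, laplacian φ (x - t) * g t := by
  have h2 : ∀ {f : Plane → ℝ}, ContDiff ℝ ∞ f → ∀ y, ContDiffAt ℝ 2 f y := fun hf y =>
    (contDiff_infty.1 hf 2).contDiffAt
  have hcf : ∀ {f : Plane → ℝ}, HasCompactSupport f → ∀ e, HasCompactSupport fun y => fderiv ℝ f y e :=
    fun hf e => hf.fderiv_apply ℝ e
  let b := stdOrthonormalBasis ℝ Plane
  rw [laplacian_eq_sum_fderiv_fderiv b (h2 (contDiff_mollify hφ hc hg) x)]
  simp only [fderiv_mollify_apply hφ hc hg, laplacian_eq_sum_fderiv_fderiv b (h2 hφ _)]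
  have : ∀ i, fderiv ℝ (fun y => mollify (fun z => fderiv ℝ φ z (b i)) g y) x (b i) =
      ∫ t, fderiv ℝ (fun z => fderiv ℝ φ z (b i)) (x - t) (b i) * g t := fun i => by
    rw [← mollify_apply (fun y => fderiv ℝ (fun z => fderiv ℝ φ z (b i)) y (b i))]
    exact fderiv_mollify_apply (contDiff_fderiv_apply hφ _) (hcf hc _) hg _ _
  simp only [this, Finset.sum_mul]
  rw [integral_finsetSum]
  exact fun i _ => integrable_mollify_integrand
    (φ := fun y => fderiv ℝ (fun z => fderiv ℝ φ z (b i)) y (b i))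
    (contDiff_fderiv_apply (contDiff_fderiv_apply hφ _) _).continuous (hcf (hcf hc _) _) hg x

/-- The Laplacian of the convolution falls on the kernel, and the reflected kernel
$t\mapsto\varphi(x-t)$ is an admissible test function because its support lies in `closedBall x ε`.
-/
lemma laplacian_mollify_eq_zero {φ v : Plane → ℝ} {K : Set Plane} (hK : IsOpen K)
    (hφ : ContDiff ℝ ∞ φ) {ε : ℝ} (hs : Function.support φ ⊆ closedBall 0 ε)
    (hv : IntegrableOn v K) (hw : HasWeakLaplacian v 0 K) {x : Plane} (hx : closedBall x ε ⊆ K) :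
    laplacian (mollify φ (K.indicator v)) x = 0 := by
  have hc : HasCompactSupport φ := HasCompactSupport.of_support_subset_isCompact
    (isCompact_closedBall 0 ε) hs
  have hint : Integrable (K.indicator v) := (integrable_indicator_iff hK.measurableSet).2 hv
  rw [laplacian_mollify hφ hc hint.locallyIntegrable]
  have hsupp : Function.support (fun t => φ (x - t)) ⊆ closedBall x ε := fun t ht => by
    have := hs (show x - t ∈ Function.support φ from ht)
    simpa [dist_eq_norm, norm_sub_rev] using this
  have hη := hw (fun t => φ (x - t)) (hφ.comp (contDiff_const.sub contDiff_id))
    (HasCompactSupport.of_support_subset_isCompact (isCompact_closedBall x ε) hsupp)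
    ((closure_minimal hsupp isClosed_closedBall).trans hx)
  simp only [laplacian_comp_const_sub, Pi.zero_apply, zero_mul, integral_zero] at hη
  rw [← hη, ← integral_indicator hK.measurableSet]
  congr 1
  ext t
  by_cases ht : t ∈ K
  · simp [ht, mul_comm]
  · simp [ht]

/-- Suppose the value $M$ at `x₀` is positive. The set $\{v\ge M/2\}$ is a compact subset of `K`;
near it a fine mollification `h` is harmonic, and on it `h` is within $M/8$ of `v`. On the boundary
of $\{v>M/2\}$ this gives $h\le M/2+M/8$, whereas $h(x_0)\ge M-M/8$, against the maximum principle.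
-/
lemma le_zero_of_hasWeakLaplacian_zero {v : Plane → ℝ} {K : Set Plane} (hK : IsOpen K)
    (hb : Bornology.IsBounded K) (cv : ContinuousOn v (closure K)) (hw : HasWeakLaplacian v 0 K)
    (h0 : ∀ x ∈ frontier K, v x ≤ 0) : ∀ x ∈ closure K, v x ≤ 0 := by
  intro x₀ hx₀
  by_contra! hpos
  set M := v x₀ with hM
  have hcpt := hb.isCompact_closure
  set C := closure K ∩ v ⁻¹' Ici (M / 2) with hC
  have hCcpt : IsCompact C := hcpt.of_isClosed_subset
    (cv.preimage_isClosed_of_isClosed isClosed_closure isClosed_Ici) inter_subset_left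
  have hCK : C ⊆ K := fun x hx => by
    by_contra hn
    have := h0 x (by rw [hK.frontier_eq]; exact ⟨hx.1, hn⟩)
    have h2 : M / 2 ≤ v x := hx.2
    linarith
  obtain ⟨δ, hδ, hδK⟩ := hCcpt.exists_cthickening_subset_open hK hCK
  obtain ⟨δ', hδ', hunif⟩ := Metric.uniformContinuousOn_iff_le.1
    (hcpt.uniformContinuousOn_of_continuous cv) (M / 8) (by linarith)
  -- The bound $\delta/2$ keeps the `ε`-balls around a whole neighbourhood of `C` inside `K`; the
  -- bound `δ'` keeps the oscillation of `v` on them below $M/8$.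
  set ε := min (δ / 2) δ' with hε
  have hεpos : 0 < ε := lt_min (by linarith) hδ'
  let ρ : ContDiffBump (0 : Plane) := ⟨ε / 2, ε, by linarith, by linarith⟩
  set g := K.indicator v with hg
  have hint : Integrable g := (integrable_indicator_iff hK.measurableSet).2
    (integrableOn_of_continuousOn_closure hb cv)
  have hρ : ContDiff ℝ ∞ (ρ.normed volume) := ρ.contDiff_normed
  have hρs : Function.support (ρ.normed (volume : Measure Plane)) ⊆ closedBall 0 ε := by
    rw [ρ.support_normed_eq]; exact ball_subset_closedBall
  set h := mollify (ρ.normed volume) g with hh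
  have hsm : ContDiff ℝ ∞ h := contDiff_mollify hρ ρ.hasCompactSupport_normed
    hint.locallyIntegrable
  have hball : ∀ x ∈ thickening (δ / 2) C, closedBall x ε ⊆ K := fun x hx y hy => by
    obtain ⟨z, hz, hxz⟩ := mem_thickening_iff.1 hx
    refine hδK (mem_cthickening_of_dist_le y z δ C hz ?_)
    have h1 : dist y x ≤ δ / 2 := (mem_closedBall.1 hy).trans (min_le_left _ _)
    linarith [dist_triangle y x z]
  have hCt : C ⊆ thickening (δ / 2) C := self_subset_thickening (by linarith) C
  have hclose : ∀ x ∈ C, |h x - v x| ≤ M / 8 := fun x hx => by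
    have hgx : g x = v x := indicator_of_mem (hCK hx) v
    have := ρ.dist_normed_convolution_le (μ := (volume : Measure Plane)) (g := g) (x₀ := x)
      (ε := M / 8) hint.aestronglyMeasurable (fun y hy => by
        have hyK : y ∈ K := hball x (hCt hx) (ball_subset_closedBall hy)
        rw [hgx, hg, indicator_of_mem hyK]
        exact hunif y (subset_closure hyK) x hx.1
          ((mem_ball.1 hy).le.trans (min_le_right _ _)))
    rw [hgx, Real.dist_eq, ← convolution_flip] at this
    exact this
  set V := {x ∈ K | M / 2 < v x} with hV
  have hVo : IsOpen V := (cv.mono subset_closure).isOpen_inter_preimage hK isOpen_Ioi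
  have hVC : V ⊆ C := fun x hx => ⟨subset_closure hx.1, le_of_lt hx.2⟩
  have hVcl : closure V ⊆ C := closure_minimal hVC hCcpt.isClosed
  have hharm : HarmonicContOnCl h V := by
    refine ⟨fun x hx => ⟨(contDiff_infty.1 hsm 2).contDiffAt, ?_⟩, hsm.continuous.continuousOn⟩
    filter_upwards [isOpen_thickening.mem_nhds (hCt (hVC hx))] with y hy
    exact laplacian_mollify_eq_zero hK hρ hρs (integrableOn_of_continuousOn_closure hb cv) hw
      (hball y hy)
  have hx₀C : x₀ ∈ C := ⟨hx₀, show M / 2 ≤ v x₀ by linarith⟩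
  have hx₀V : x₀ ∈ V := ⟨hCK hx₀C, show M / 2 < v x₀ by linarith⟩
  have hle := HarmonicContOnCl.plane_le_of_le_frontier hVo (hb.subset fun x hx => hx.1) hharm
    (M := M / 2 + M / 8) (fun x hx => by
      have hxC := hVcl (frontier_subset_closure hx)
      have h1 := (abs_le.1 (hclose x hxC)).2
      have h2 : v x ≤ M / 2 := by
        by_contra! hn
        rw [hVo.frontier_eq] at hx
        exact hx.2 ⟨hCK hxC, hn⟩
      linarith) x₀ (subset_closure hx₀V)
  have := (abs_le.1 (hclose x₀ hx₀C)).1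
  linarith

/-- A weakly harmonic function, continuous up to the boundary and zero there, vanishes. -/
lemma eq_zero_of_hasWeakLaplacian_zero {v : Plane → ℝ} {K : Set Plane} (hK : IsOpen K)
    (hb : Bornology.IsBounded K) (cv : ContinuousOn v (closure K)) (hw : HasWeakLaplacian v 0 K)
    (h0 : ∀ x ∈ frontier K, v x = 0) : ∀ x ∈ closure K, v x = 0 := by
  intro x hx
  refine le_antisymm (le_zero_of_hasWeakLaplacian_zero hK hb cv hw (fun y hy => (h0 y hy).le) x hx) ?_
  have := le_zero_of_hasWeakLaplacian_zero hK hb cv.neg (fun η h1 h2 h3 => by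
    have := hw η h1 h2 h3
    simpa [integral_neg] using this) (fun y hy => by simp [h0 y hy]) x hx
  simpa using this

/-! ### The energy argument -/

/-- A smooth monotone cutoff of the identity near the origin. -/
noncomputable def softThreshold (t : ℝ) : ℝ := t * Real.smoothTransition (t ^ 2 - 1)

lemma contDiff_softThreshold : ContDiff ℝ ∞ softThreshold :=
  contDiff_id.mul (Real.smoothTransition.contDiff.comp ((contDiff_id.pow 2).sub contDiff_const))

lemma softThreshold_of_abs_le_one {t : ℝ} (h : |t| ≤ 1) : softThreshold t = 0 := by
  have : t ^ 2 ≤ 1 := (sq_le_one_iff_abs_le_one t).2 h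
  rw [softThreshold, Real.smoothTransition.zero_of_nonpos (by linarith), mul_zero]

lemma softThreshold_of_two_le_abs {t : ℝ} (h : 2 ≤ |t|) : softThreshold t = t := by
  have : 4 ≤ t ^ 2 := by nlinarith [sq_abs t]
  rw [softThreshold, Real.smoothTransition.one_of_one_le (by linarith), mul_one]

lemma abs_softThreshold_sub_le (t : ℝ) : |softThreshold t - t| ≤ 2 := by
  rcases le_total 2 |t| with h | h
  · simp [softThreshold_of_two_le_abs h]
  · have h1 := Real.smoothTransition.nonneg (t ^ 2 - 1)
    have h2 := Real.smoothTransition.le_one (t ^ 2 - 1)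
    rw [softThreshold, show t * Real.smoothTransition (t ^ 2 - 1) - t =
      t * -(1 - Real.smoothTransition (t ^ 2 - 1)) by ring, abs_mul, abs_neg,
      abs_of_nonneg (a := 1 - Real.smoothTransition (t ^ 2 - 1)) (by linarith)]
    nlinarith [abs_nonneg t]

/-- This sign makes the truncated energy density nonnegative, so the energy over `K` dominates the
energy over any ball. -/
lemma deriv_softThreshold_nonneg (t : ℝ) : 0 ≤ deriv softThreshold t := by
  have hS : Differentiable ℝ Real.smoothTransition :=
    (Real.smoothTransition.contDiff (n := 1)).differentiable one_ne_zero
  have h1 : HasDerivAt (fun t : ℝ => t ^ 2 - 1) (2 * t) t := by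
    simpa using (hasDerivAt_pow 2 t).sub_const 1
  have h2 := (hasDerivAt_id t).mul ((hS (t ^ 2 - 1)).hasDerivAt.comp t h1)
  have h3 : deriv softThreshold t = Real.smoothTransition (t ^ 2 - 1) +
      t * (deriv Real.smoothTransition (t ^ 2 - 1) * (2 * t)) := by
    refine h2.deriv.trans ?_
    simp
  rw [h3]
  have h4 := Real.smoothTransition.nonneg (t ^ 2 - 1)
  have h5 : 0 ≤ deriv Real.smoothTransition (t ^ 2 - 1) := Real.smoothTransition.monotone.deriv_nonneg
  have h6 : t * (deriv Real.smoothTransition (t ^ 2 - 1) * (2 * t)) =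
    2 * t ^ 2 * deriv Real.smoothTransition (t ^ 2 - 1) := by ring
  rw [h6]
  positivity

lemma deriv_softThreshold_of_two_lt_abs {t : ℝ} (h : 2 < |t|) : deriv softThreshold t = 1 := by
  have : softThreshold =ᶠ[𝓝 t] id := by
    filter_upwards [continuous_abs.continuousAt.eventually (lt_mem_nhds h)] with s hs
    exact softThreshold_of_two_le_abs (le_of_lt hs)
  rw [this.deriv_eq, deriv_id]

end VEM

namespace VEM

open Filter Topology Metric Real InnerProductSpace Laplacian

/-! ### Integration by parts against truncations -/

lemma integrable_mul_of_tsupport_subset {f g : Plane → ℝ} {K : Set Plane} (hf : Continuous f)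
    (hc : HasCompactSupport f) (hK : tsupport f ⊆ K) (hg : ContinuousOn g K) :
    Integrable fun x => f x * g x := by
  have h1 : IntegrableOn (fun x => f x * g x) (tsupport f) :=
    (hf.continuousOn.mul (hg.mono hK)).integrableOn_compact hc.isCompact
  refine (integrableOn_iff_integrable_of_support_subset fun x hx => ?_).1 h1
  exact subset_tsupport f fun h => hx (by simp [h])

/-- The squared norm of the gradient. -/
noncomputable def gradSq (u : Plane → ℝ) (x : Plane) : ℝ :=
  ∑ i, (fderiv ℝ u x (stdOrthonormalBasis ℝ Plane i)) ^ 2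

lemma gradSq_nonneg (u : Plane → ℝ) (x : Plane) : 0 ≤ gradSq u x :=
  Finset.sum_nonneg fun _ _ => sq_nonneg _

lemma fderiv_eq_zero_of_gradSq_eq_zero {u : Plane → ℝ} {x : Plane} (h : gradSq u x = 0) :
    fderiv ℝ u x = 0 := by
  have h1 := (Finset.sum_eq_zero_iff_of_nonneg fun _ _ => sq_nonneg _).1 h
  have h2 : (fderiv ℝ u x : Plane →ₗ[ℝ] ℝ) = 0 :=
    (stdOrthonormalBasis ℝ Plane).toBasis.ext fun i => by
      simpa using h1 i (Finset.mem_univ i)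
  ext v
  exact LinearMap.congr_fun h2 v

section Energy

variable {u q : Plane → ℝ} {K : Set Plane}

lemma continuousOn_fderiv_apply (hu : ∀ x ∈ K, ContDiffAt ℝ ∞ u x) (e : Plane) :
    ContinuousOn (fun x => fderiv ℝ u x e) K := fun x hx =>
  ((((hu x hx).fderiv_right (m := ∞) (by simp)).continuousAt).clm_apply
    continuousAt_const).continuousWithinAt

lemma continuousOn_gradSq (hu : ∀ x ∈ K, ContDiffAt ℝ ∞ u x) : ContinuousOn (gradSq u) K :=
  continuousOn_finsetSum _ fun _ _ => (continuousOn_fderiv_apply hu _).pow 2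

/-- The truncation of `u` which vanishes near the boundary of `K`. -/
noncomputable def truncation (u : Plane → ℝ) (K : Set Plane) (δ : ℝ) : Plane → ℝ :=
  K.indicator fun x => δ * softThreshold (u x / δ)

/-- Since `u` vanishes on the frontier, $\{|u|\ge\delta\}$ is a compact subset of `K`, and the
truncation is zero off it. -/
lemma truncation_tsupport (hK : IsOpen K) (hb : Bornology.IsBounded K)
    (cu : ContinuousOn u (closure K)) (h0 : ∀ x ∈ frontier K, u x = 0) {δ : ℝ} (hδ : 0 < δ) :
    HasCompactSupport (truncation u K δ) ∧ tsupport (truncation u K δ) ⊆ K := by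
  set C := closure K ∩ (fun x => |u x|) ⁻¹' Ici δ with hC
  have hCcpt : IsCompact C := hb.isCompact_closure.of_isClosed_subset
    (cu.abs.preimage_isClosed_of_isClosed isClosed_closure isClosed_Ici) inter_subset_left
  have hCK : C ⊆ K := fun x hx => by
    by_contra hn
    have := h0 x (by rw [hK.frontier_eq]; exact ⟨hx.1, hn⟩)
    have h2 : δ ≤ |u x| := hx.2
    rw [this, abs_zero] at h2
    linarith
  have hsupp : Function.support (truncation u K δ) ⊆ C := fun x hx => by
    have hxK : x ∈ K := by
      by_contra hn
      exact hx (indicator_of_notMem hn _)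
    refine ⟨subset_closure hxK, ?_⟩
    by_contra hn
    have hn : |u x| < δ := by simpa using hn
    apply hx
    rw [truncation, indicator_of_mem hxK, softThreshold_of_abs_le_one, mul_zero]
    rw [abs_div, abs_of_pos hδ, div_le_one hδ]
    exact hn.le
  exact ⟨HasCompactSupport.of_support_subset_isCompact hCcpt hsupp,
    (closure_minimal hsupp hCcpt.isClosed).trans hCK⟩

lemma truncation_eventuallyEq (hK : IsOpen K) {δ : ℝ} {x : Plane} (hx : x ∈ K) :
    truncation u K δ =ᶠ[𝓝 x] fun x => δ * softThreshold (u x / δ) := by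
  filter_upwards [hK.mem_nhds hx] with y hy using indicator_of_mem hy _

lemma contDiff_truncation (hK : IsOpen K) (hu : ∀ x ∈ K, ContDiffAt ℝ ∞ u x) {δ : ℝ}
    (hts : tsupport (truncation u K δ) ⊆ K) : ContDiff ℝ ∞ (truncation u K δ) := by
  rw [contDiff_iff_contDiffAt]
  intro x
  by_cases hx : x ∈ K
  · refine ContDiffAt.congr_of_eventuallyEq ?_ (truncation_eventuallyEq hK hx)
    exact contDiffAt_const.mul (contDiff_softThreshold.contDiffAt.comp x
      ((hu x hx).div_const δ))
  · exact contDiffAt_const.congr_of_eventuallyEq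
      (notMem_tsupport_iff_eventuallyEq.1 fun h => hx (hts h))

lemma fderiv_truncation (hK : IsOpen K) (hu : ∀ x ∈ K, ContDiffAt ℝ ∞ u x) {δ : ℝ} (hδ : 0 < δ)
    {x : Plane} (hx : x ∈ K) (e : Plane) :
    fderiv ℝ (truncation u K δ) x e = deriv softThreshold (u x / δ) * fderiv ℝ u x e := by
  have h1 : HasFDerivAt u (fderiv ℝ u x) x := ((hu x hx).differentiableAt (by simp)).hasFDerivAt
  have h2 : HasDerivAt softThreshold (deriv softThreshold (u x / δ)) (u x / δ) :=
    (contDiff_softThreshold.differentiable (by simp) _).hasDerivAt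
  have h3 : HasFDerivAt (fun y => u y / δ) (δ⁻¹ • fderiv ℝ u x) x := by
    simpa [div_eq_inv_mul] using h1.const_mul δ⁻¹
  have h4 := (h2.comp_hasFDerivAt x h3).const_mul δ
  rw [(truncation_eventuallyEq hK hx).fderiv_eq]
  have h5 : fderiv ℝ (fun x => δ * softThreshold (u x / δ)) x = _ := h4.fderiv
  rw [h5]
  simp
  field_simp

/-- The truncation has compact support in `K`, so integration by parts has no boundary term and
needs no regularity of `u` up to the boundary. By the chain rule its gradient is $S'(u/\delta)\nabla
u$, with $S$ the soft threshold. -/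
lemma setIntegral_truncation_mul_laplacian (hK : IsOpen K) (hb : Bornology.IsBounded K)
    (cu : ContinuousOn u (closure K)) (h0 : ∀ x ∈ frontier K, u x = 0)
    (hu : ∀ x ∈ K, ContDiffAt ℝ ∞ u x) (hq : ∀ x ∈ K, laplacian u x = q x) {δ : ℝ} (hδ : 0 < δ) :
    IntegrableOn (fun x => deriv softThreshold (u x / δ) * gradSq u x) K ∧
    ∫ x in K, truncation u K δ x * q x =
      -∫ x in K, deriv softThreshold (u x / δ) * gradSq u x := by
  obtain ⟨hc, hts⟩ := truncation_tsupport hK hb cu h0 hδ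
  have hw := contDiff_truncation hK hu hts
  set w := truncation u K δ with hwdef
  let b := stdOrthonormalBasis ℝ Plane
  have hwi : ∀ e, Continuous fun x => fderiv ℝ w x e := fun e => (contDiff_fderiv_apply hw e).continuous
  have hui : ∀ e, ∀ x ∈ K, ContDiffAt ℝ ∞ (fun y => fderiv ℝ u y e) x := fun e x hx =>
    ((hu x hx).fderiv_right (m := ∞) (by simp)).clm_apply contDiffAt_const
  have hts' : ∀ e, tsupport (fun x => fderiv ℝ w x e) ⊆ K := fun e =>
    (tsupport_fderiv_apply_subset ℝ e).trans hts
  have i1 : ∀ i, Integrable fun x => fderiv ℝ w x (b i) * fderiv ℝ u x (b i) := fun i =>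
    integrable_mul_of_tsupport_subset (hwi _) (hc.fderiv_apply ℝ _) (hts' _)
      (continuousOn_fderiv_apply hu _)
  have i2 : ∀ i, Integrable fun x => w x * fderiv ℝ (fun y => fderiv ℝ u y (b i)) x (b i) :=
    fun i => integrable_mul_of_tsupport_subset hw.continuous hc hts
      (continuousOn_fderiv_apply (hui _) _)
  have i3 : ∀ i, Integrable fun x => w x * fderiv ℝ u x (b i) := fun i =>
    integrable_mul_of_tsupport_subset hw.continuous hc hts (continuousOn_fderiv_apply hu _)
  have key : ∀ i, ∫ x, w x * fderiv ℝ (fun y => fderiv ℝ u y (b i)) x (b i) =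
      -∫ x, fderiv ℝ w x (b i) * fderiv ℝ u x (b i) := fun i =>
    integral_mul_fderiv_eq_neg_fderiv_mul_of_integrable (i1 i) (i2 i) (i3 i)
      (fun x _ => hw.differentiable (by simp) x)
      (fun x hx => (hui _ x (hts hx)).differentiableAt (by simp))
  have e1 : ∀ x ∈ K, w x * q x =
      ∑ i, w x * fderiv ℝ (fun y => fderiv ℝ u y (b i)) x (b i) := fun x hx => by
    rw [← Finset.mul_sum, ← laplacian_eq_sum_fderiv_fderiv b
      (contDiffAt_infty.1 (hu x hx) 2), hq x hx]
  have e2 : ∀ x ∈ K, deriv softThreshold (u x / δ) * gradSq u x =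
      ∑ i, fderiv ℝ w x (b i) * fderiv ℝ u x (b i) := fun x hx => by
    rw [gradSq, Finset.mul_sum]
    refine Finset.sum_congr rfl fun i _ => ?_
    rw [hwdef, fderiv_truncation hK hu hδ hx]
    ring
  have hsum := integrable_finsetSum Finset.univ fun i _ => i1 i
  refine ⟨(integrableOn_congr_fun e2 hK.measurableSet).2 hsum.integrableOn, ?_⟩
  have hwz : ∀ x ∉ K, w x = 0 := fun x hx => indicator_of_notMem hx _
  have hdz : ∀ e, ∀ x ∉ K, fderiv ℝ w x e = 0 := fun e x hx => by
    by_contra hn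
    exact hx (hts' e (subset_tsupport _ hn))
  rw [setIntegral_congr_fun hK.measurableSet e1, setIntegral_congr_fun hK.measurableSet e2,
    setIntegral_eq_integral_of_forall_compl_eq_zero fun x hx => by simp [hwz x hx],
    setIntegral_eq_integral_of_forall_compl_eq_zero fun x hx => by simp [hdz _ x hx],
    integral_finsetSum _ fun i _ => i2 i, integral_finsetSum _ fun i _ => i1 i,
    ← Finset.sum_neg_distrib]
  exact Finset.sum_congr rfl fun i _ => key i

lemma abs_truncation_sub_le {δ : ℝ} (hδ : 0 < δ) {x : Plane} (hx : x ∈ K) :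
    |truncation u K δ x - u x| ≤ 2 * δ := by
  have h1 := abs_softThreshold_sub_le (u x / δ)
  rw [truncation, indicator_of_mem hx]
  have h2 : δ * softThreshold (u x / δ) - u x = δ * (softThreshold (u x / δ) - u x / δ) := by
    field_simp
  rw [h2, abs_mul, abs_of_pos hδ]
  nlinarith

/-- Orthogonality lets `u` be subtracted from its truncation, so the truncated energy is at most
$2\delta\int_K|q|$ and tends to 0. If `u` and its gradient were both nonzero at `x₀`, then on a
fixed ball the energy density would stay bounded below for all small `δ`. -/
lemma mul_gradSq_eq_zero (hK : IsOpen K) (hb : Bornology.IsBounded K)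
    (cu : ContinuousOn u (closure K)) (cq : ContinuousOn q (closure K))
    (h0 : ∀ x ∈ frontier K, u x = 0) (hu : ∀ x ∈ K, ContDiffAt ℝ ∞ u x)
    (hq : ∀ x ∈ K, laplacian u x = q x) (horth : ∫ x in K, u x * q x = 0) {x₀ : Plane}
    (hx₀ : x₀ ∈ K) : u x₀ = 0 ∨ gradSq u x₀ = 0 := by
  by_contra! hne
  obtain ⟨hu0, hg0⟩ := hne
  have hg0 : 0 < gradSq u x₀ := lt_of_le_of_ne (gradSq_nonneg u x₀) (Ne.symm hg0)
  have ha : 0 < |u x₀| := abs_pos.2 hu0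
  have n1 : ∀ᶠ x in 𝓝 x₀, gradSq u x₀ / 2 < gradSq u x :=
    ((continuousOn_gradSq hu).continuousAt (hK.mem_nhds hx₀)).eventually
      (lt_mem_nhds (by linarith))
  have n2 : ∀ᶠ x in 𝓝 x₀, |u x₀| / 2 < |u x| :=
    (hu x₀ hx₀).continuousAt.abs.eventually (lt_mem_nhds (by linarith))
  obtain ⟨r, hr, hball⟩ := Metric.eventually_nhds_iff_ball.1 (n1.and (n2.and (hK.mem_nhds hx₀)))
  have hBK : ball x₀ r ⊆ K := fun x hx => (hball x hx).2.2
  set m := (volume : Measure Plane).real (ball x₀ r) with hm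
  have hmpos : 0 < m := ENNReal.toReal_pos (measure_ball_pos volume x₀ hr).ne'
    measure_ball_lt_top.ne
  set Q := ∫ x in K, |q x| with hQ
  have hqint : IntegrableOn q K := integrableOn_of_continuousOn_closure hb cq
  -- On the ball $|u|>|u(x_0)|/2$, so this bound on `δ` gives $|u/\delta|>2$, where the soft
  -- threshold has derivative 1.
  have main : ∀ δ : ℝ, 0 < δ → δ < |u x₀| / 4 → gradSq u x₀ / 2 * m ≤ 2 * δ * Q := by
    intro δ hδ hδ'
    obtain ⟨hint, heq⟩ := setIntegral_truncation_mul_laplacian hK hb cu h0 hu hq hδ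
    obtain ⟨hc, hts⟩ := truncation_tsupport hK hb cu h0 hδ
    have hw := contDiff_truncation hK hu hts
    have hlow : gradSq u x₀ / 2 * m ≤ ∫ x in K, deriv softThreshold (u x / δ) * gradSq u x := by
      calc gradSq u x₀ / 2 * m = ∫ x in ball x₀ r, gradSq u x₀ / 2 := by
            rw [setIntegral_const, smul_eq_mul, mul_comm]
        _ ≤ ∫ x in ball x₀ r, deriv softThreshold (u x / δ) * gradSq u x := by
            refine setIntegral_mono_on (integrableOn_const measure_ball_lt_top.ne)
              (hint.mono_set hBK) measurableSet_ball fun x hx => ?_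
            obtain ⟨g1, g2, -⟩ := hball x hx
            rw [deriv_softThreshold_of_two_lt_abs, one_mul]
            · exact g1.le
            · rw [abs_div, abs_of_pos hδ, lt_div_iff₀ hδ]
              linarith
        _ ≤ _ := setIntegral_mono_set hint
            (Eventually.of_forall fun x => mul_nonneg (deriv_softThreshold_nonneg _)
              (gradSq_nonneg u x)) (LE.le.eventuallyLE hBK)
    have hup : |∫ x in K, truncation u K δ x * q x| ≤ 2 * δ * Q := by
      have hd : ∫ x in K, truncation u K δ x * q x =
          ∫ x in K, (truncation u K δ x - u x) * q x := by
        simp only [sub_mul]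
        rw [integral_sub (integrableOn_mul_of_continuousOn_closure hb hw.continuous.continuousOn cq)
          (integrableOn_mul_of_continuousOn_closure hb cu cq), horth, sub_zero]
      rw [hd, hQ, ← integral_const_mul]
      refine (abs_integral_le_integral_abs).trans (setIntegral_mono_on ?_ ?_ hK.measurableSet ?_)
      · exact (integrableOn_mul_of_continuousOn_closure hb
          (hw.continuous.continuousOn.sub cu) cq).abs
      · exact hqint.abs.const_mul _
      · intro x hx
        rw [abs_mul]
        exact mul_le_mul_of_nonneg_right (abs_truncation_sub_le hδ hx) (abs_nonneg _)
    rw [heq, abs_neg] at hup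
    exact hlow.trans ((le_abs_self _).trans hup)
  have hpos : 0 < gradSq u x₀ / 2 * m := by positivity
  have hlim : Tendsto (fun δ : ℝ => 2 * δ * Q) (𝓝[>] 0) (𝓝 0) := by
    have : Continuous fun δ : ℝ => 2 * δ * Q := by fun_prop
    simpa using (this.tendsto 0).mono_left nhdsWithin_le_nhds
  obtain ⟨δ, h1, h2, h3⟩ := ((hlim.eventually (gt_mem_nhds hpos)).and
    (Ioo_mem_nhdsGT (show 0 < |u x₀| / 4 by linarith))).exists
  linarith [main δ h2 h3]

/-- A function vanishing on the boundary and orthogonal to its own Laplacian vanishes. -/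
theorem eq_zero_of_integral_mul_laplacian_eq_zero (hK : IsOpen K) (hb : Bornology.IsBounded K)
    (cu : ContinuousOn u (closure K)) (cq : ContinuousOn q (closure K))
    (h0 : ∀ x ∈ frontier K, u x = 0) (hu : ∀ x ∈ K, ContDiffAt ℝ ∞ u x)
    (hq : ∀ x ∈ K, laplacian u x = q x) (horth : ∫ x in K, u x * q x = 0) :
    ∀ x ∈ closure K, u x = 0 := by
  -- The product $u\nabla u$ vanishes everywhere, so $u^2$ is locally constant, hence harmonic. Its
  -- boundary values are 0, and the maximum principle gives $u^2\le 0$.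
  have hd : ∀ x ∈ K, HasFDerivAt (fun y => u y ^ 2) (0 : Plane →L[ℝ] ℝ) x := fun x hx => by
    have h1 : HasFDerivAt u (fderiv ℝ u x) x := ((hu x hx).differentiableAt (by simp)).hasFDerivAt
    have h2 := h1.pow 2
    rcases mul_gradSq_eq_zero hK hb cu cq h0 hu hq horth hx with h | h
    · simpa [h] using h2
    · simpa [fderiv_eq_zero_of_gradSq_eq_zero h] using h2
  have hharm : HarmonicContOnCl (fun y => u y ^ 2) K := by
    refine ⟨fun x hx => ?_, cu.pow 2⟩
    obtain ⟨r, hr, hball⟩ := Metric.isOpen_iff.1 hK x hx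
    refine (harmonicAt_congr_nhds (f₂ := fun _ => u x ^ 2) ?_).2 (harmonicAt_const _)
    filter_upwards [ball_mem_nhds x hr] with y hy
    exact (convex_ball x r).is_const_of_fderivWithin_eq_zero (𝕜 := ℝ)
      (fun z hz => (hd z (hball hz)).differentiableAt.differentiableWithinAt)
      (fun z hz => by
        rw [fderivWithin_of_isOpen isOpen_ball hz, (hd z (hball hz)).fderiv]) hy
      (mem_ball_self hr)
  intro x hx
  have := HarmonicContOnCl.plane_le_of_le_frontier hK hb hharm (M := 0)
    (fun y hy => by simp [h0 y hy]) x hx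
  exact pow_eq_zero_iff two_ne_zero |>.1 (le_antisymm this (sq_nonneg _))

end Energy

end VEM

namespace VEM

open Filter Topology Metric Real InnerProductSpace Laplacian MvPolynomial

/-! ### Polynomials -/

lemma polyFun_add (p q : MvPolynomial (Fin 2) ℝ) (x : Plane) :
    polyFun (p + q) x = polyFun p x + polyFun q x := by simp [polyFun]

lemma polyFun_smul (c : ℝ) (p : MvPolynomial (Fin 2) ℝ) (x : Plane) :
    polyFun (c • p) x = c * polyFun p x := by simp [polyFun, smul_eval]

lemma polyFun_sum {α : Type*} (s : Finset α) (p : α → MvPolynomial (Fin 2) ℝ) (x : Plane) :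
    polyFun (∑ i ∈ s, p i) x = ∑ i ∈ s, polyFun (p i) x := by simp [polyFun]

lemma polyFun_sub (p q : MvPolynomial (Fin 2) ℝ) (x : Plane) :
    polyFun (p - q) x = polyFun p x - polyFun q x := by simp [polyFun]

lemma hasFDerivAt_polyFun (q : MvPolynomial (Fin 2) ℝ) (x : Plane) :
    HasFDerivAt (polyFun q)
      (∑ j, polyFun (pderiv j q) x • (EuclideanSpace.proj j : Plane →L[ℝ] ℝ)) x := by
  induction q using MvPolynomial.induction_on with
  | C a =>
    have : polyFun (C a) = fun _ => a := by ext; simp [polyFun]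
    rw [this]
    simpa [polyFun] using hasFDerivAt_const a x
  | add p q hp hq =>
    have : polyFun (p + q) = fun y => polyFun p y + polyFun q y := by ext; simp [polyFun]
    rw [this]
    refine (hp.add hq).congr_fderiv ?_
    simp only [map_add, polyFun_add, add_smul, Finset.sum_add_distrib]
  | mul_X p i hp =>
    have : polyFun (p * X i) = fun y => polyFun p y * (EuclideanSpace.proj i : Plane →L[ℝ] ℝ) y := by
      ext; simp [polyFun]
    rw [this]
    have h2 : HasFDerivAt (fun y : Plane => (EuclideanSpace.proj i : Plane →L[ℝ] ℝ) y)
      (EuclideanSpace.proj i : Plane →L[ℝ] ℝ) x := ContinuousLinearMap.hasFDerivAt _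
    refine (hp.mul h2).congr_fderiv ?_
    ext v
    fin_cases i <;> simp [Derivation.leibniz, pderiv_X, polyFun] <;> ring

lemma contDiff_polyFun (q : MvPolynomial (Fin 2) ℝ) : ContDiff ℝ ∞ (polyFun q) := by
  induction q using MvPolynomial.induction_on with
  | C a =>
    have : polyFun (C a) = fun _ => a := by ext; simp [polyFun]
    rw [this]
    exact contDiff_const
  | add p q hp hq =>
    have : polyFun (p + q) = fun y => polyFun p y + polyFun q y := by ext; simp [polyFun]
    rw [this]
    exact hp.add hq
  | mul_X p i hp =>
    have : polyFun (p * X i) = fun y => polyFun p y * (EuclideanSpace.proj i : Plane →L[ℝ] ℝ) y := by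
      ext; simp [polyFun]
    rw [this]
    exact hp.mul (ContinuousLinearMap.contDiff _)

/-- The Laplacian on polynomials. -/
noncomputable def polyLaplacian : MvPolynomial (Fin 2) ℝ →ₗ[ℝ] MvPolynomial (Fin 2) ℝ :=
  ∑ j : Fin 2, (pderiv j : Derivation ℝ _ _).toLinearMap ∘ₗ (pderiv j : Derivation ℝ _ _).toLinearMap

lemma polyLaplacian_apply (q : MvPolynomial (Fin 2) ℝ) :
    polyLaplacian q = pderiv 0 (pderiv 0 q) + pderiv 1 (pderiv 1 q) := by
  simp [polyLaplacian, Fin.sum_univ_two]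

lemma fderiv_polyFun_basis (q : MvPolynomial (Fin 2) ℝ) (x : Plane) (j : Fin 2) :
    fderiv ℝ (polyFun q) x (EuclideanSpace.basisFun (Fin 2) ℝ j) = polyFun (pderiv j q) x := by
  rw [(hasFDerivAt_polyFun q x).fderiv]
  fin_cases j <;> simp [Fin.sum_univ_two]

lemma laplacian_polyFun (q : MvPolynomial (Fin 2) ℝ) (x : Plane) :
    laplacian (polyFun q) x = polyFun (polyLaplacian q) x := by
  rw [laplacian_eq_sum_fderiv_fderiv (EuclideanSpace.basisFun (Fin 2) ℝ)
    (contDiff_infty.1 (contDiff_polyFun q) 2).contDiffAt]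
  simp only [fderiv_polyFun_basis, Fin.sum_univ_two, polyLaplacian_apply, polyFun_add]

/-- For $b\le 1$ the truncated exponent `b - 2` is harmless, because its coefficient $b(b-1)$
vanishes. -/
lemma polyLaplacian_X_pow (a b : ℕ) :
    polyLaplacian (X 0 ^ (a + 2) * X 1 ^ b) =
      C ((a + 2) * (a + 1) : ℝ) * (X 0 ^ a * X 1 ^ b) +
        C (b * (b - 1) : ℝ) * (X 0 ^ (a + 2) * X 1 ^ (b - 2)) := by
  have h1 : pderiv (0 : Fin 2) (2 : MvPolynomial (Fin 2) ℝ) = 0 :=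
    Derivation.map_natCast (pderiv (0 : Fin 2)) 2
  have h2 : (C 2 : MvPolynomial (Fin 2) ℝ) = 2 := map_ofNat C 2
  rcases b with _ | _ | b
  all_goals
    simp [polyLaplacian_apply, Derivation.leibniz, Derivation.leibniz_pow, pderiv_X, h1, h2]
    try ring

/-- The Laplacian of $X_0^{a+2}X_1^b$ is a nonzero multiple of $X_0^aX_1^b$ plus a term with
exponent $b-2$ in $X_1$. Induction on `b` therefore works when all `a` are treated at once. -/
lemma exists_polyLaplacian_eq_monomial (b : ℕ) : ∀ a : ℕ,
    (X 0 ^ a * X 1 ^ b : MvPolynomial (Fin 2) ℝ) ∈ LinearMap.range polyLaplacian := by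
  induction b using Nat.strong_induction_on with
  | _ b ih =>
    intro a
    have hrem : C (b * (b - 1) : ℝ) * (X 0 ^ (a + 2) * X 1 ^ (b - 2) : MvPolynomial (Fin 2) ℝ) ∈
        LinearMap.range polyLaplacian := by
      rcases b with _ | _ | b
      · simp
      · simp
      · rw [← smul_eq_C_mul]
        exact Submodule.smul_mem _ _ (ih b (by omega) (a + 2))
    have hc : ((a + 2) * (a + 1) : ℝ) ≠ 0 := by positivity
    have h1 := Submodule.sub_mem _ (LinearMap.mem_range_self polyLaplacian
      (X 0 ^ (a + 2) * X 1 ^ b)) hrem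
    rw [polyLaplacian_X_pow, add_sub_cancel_right, ← smul_eq_C_mul] at h1
    exact (Submodule.smul_mem_iff _ hc).1 h1

lemma polyLaplacian_surjective : Function.Surjective polyLaplacian := by
  rw [← LinearMap.range_eq_top, eq_top_iff]
  intro q _
  induction q using MvPolynomial.induction_on' with
  | monomial s c =>
    have : monomial s c = c • (X 0 ^ s 0 * X 1 ^ s 1 : MvPolynomial (Fin 2) ℝ) := by
      rw [monomial_eq, Finsupp.prod_fintype _ _ (by simp), Fin.prod_univ_two, smul_eq_C_mul]
    rw [this]
    exact Submodule.smul_mem _ _ (exists_polyLaplacian_eq_monomial _ _)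
  | add p q hp hq => exact Submodule.add_mem _ (hp trivial) (hq trivial)

lemma finite_multiIndex (k : ℤ) : Finite {α : Fin 2 →₀ ℕ // (α.degree : ℤ) ≤ k} := by
  refine Finite.of_injective (β := Fin 2 → Fin (k.toNat + 1)) (fun α j => ⟨α.1 j, ?_⟩) ?_
  · have h1 := Finsupp.le_degree j α.1
    have h2 := α.2
    omega
  · intro α β h
    ext j
    simpa using congrFun h j

end VEM

namespace VEM

open Filter Topology Metric Real InnerProductSpace Laplacian

/-! ### The local problem -/

lemma eq_zero_of_polyFun_eq_zero {q : MvPolynomial (Fin 2) ℝ} {K : Set Plane} (hK : IsOpen K)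
    (hne : K.Nonempty) (h : ∀ x ∈ K, polyFun q x = 0) : q = 0 := by
  obtain ⟨x, hx⟩ := hne
  have hK' : IsOpen ((WithLp.toLp 2 : (Fin 2 → ℝ) → Plane) ⁻¹' K) :=
    hK.preimage (PiLp.continuous_toLp 2 _)
  obtain ⟨r, hr, hball⟩ := Metric.isOpen_iff.1 hK' (WithLp.ofLp x) (by simpa using hx)
  -- A sup-norm ball is a product of intervals, and a polynomial vanishing on a product of infinite
  -- sets is zero.
  refine MvPolynomial.funext_set (fun j => ball (x j) r) (fun j => ?_) fun y hy => ?_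
  · rw [Real.ball_eq_Ioo]
    exact Ioo_infinite (by linarith)
  · have hy' : y ∈ ball (WithLp.ofLp x) r := by
      rw [ball_pi _ hr]
      exact hy
    simpa [polyFun] using h _ (hball hy')

lemma continuousOn_polyFun (q : MvPolynomial (Fin 2) ℝ) (s : Set Plane) :
    ContinuousOn (polyFun q) s := (contDiff_polyFun q).continuous.continuousOn

section Local

variable {K : Set Plane}

/-- Any polynomial `Q` with Laplacian `q` serves as a particular solution; subtracting the harmonic
function with boundary values $Q-g$ corrects the trace. -/
lemma exists_laplacian_eq_polyFun (hK : IsOpen K) (hb : Bornology.IsBounded K)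
    (hseg : ∀ z ∈ frontier K, ∃ z', z ≠ z' ∧ Disjoint (segment ℝ z z') K)
    {g : Plane → ℝ} (cg : ContinuousOn g (frontier K)) (q : MvPolynomial (Fin 2) ℝ) :
    ∃ u, ContinuousOn u (closure K) ∧ EqOn u g (frontier K) ∧ (∀ x ∈ K, ContDiffAt ℝ ∞ u x) ∧
      ∀ x ∈ K, laplacian u x = polyFun q x := by
  obtain ⟨Q, rfl⟩ := polyLaplacian_surjective q
  obtain ⟨h, hh, hs, he⟩ := exists_plane_harmonicContOnCl hK hb hseg
    ((continuousOn_polyFun Q (frontier K)).sub cg)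
  refine ⟨polyFun Q - h, (continuousOn_polyFun Q _).sub hh.2, fun x hx => ?_,
    fun x hx => (contDiff_polyFun Q).contDiffAt.sub (hs x hx), fun x hx => ?_⟩
  · have := he hx
    simp only [Pi.sub_apply] at this ⊢
    linarith
  · rw [(contDiff_infty.1 (contDiff_polyFun Q) 2).contDiffAt.laplacian_sub (hh.1 x hx).1,
      (hh.1 x hx).2.eq_of_nhds, laplacian_polyFun]
    simp

/-- The energy argument needs a function smooth inside `K`. The smooth solution `u` with the same
Laplacian and zero trace differs from `d` by a weakly harmonic function with zero trace, so `d = u`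
and the argument applies to `u`. -/
lemma eq_zero_of_hasWeakLaplacian_polyFun (hK : IsOpen K) (hb : Bornology.IsBounded K)
    (hseg : ∀ z ∈ frontier K, ∃ z', z ≠ z' ∧ Disjoint (segment ℝ z z') K)
    {d : Plane → ℝ} (cd : ContinuousOn d (closure K)) (h0 : ∀ x ∈ frontier K, d x = 0)
    {q : MvPolynomial (Fin 2) ℝ} (hw : HasWeakLaplacian d (polyFun q) K)
    (horth : ∫ x in K, d x * polyFun q x = 0) : ∀ x ∈ closure K, d x = 0 := by
  obtain ⟨u, cu, u0, hu, hq⟩ := exists_laplacian_eq_polyFun (g := 0) hK hb hseg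
    continuousOn_const q
  have hdu : ∀ x ∈ closure K, d x - u x = 0 := by
    refine eq_zero_of_hasWeakLaplacian_zero hK hb (cd.sub cu) ?_ fun x hx => ?_
    · have := hw.sub hb (hasWeakLaplacian_of_contDiffAt hK hu hq) cd cu
        (continuousOn_polyFun q _) (continuousOn_polyFun q _)
      simp only [sub_self] at this
      exact this
    · rw [h0 x hx, u0 hx, Pi.zero_apply, sub_zero]
  have hu0 := eq_zero_of_integral_mul_laplacian_eq_zero hK hb cu (continuousOn_polyFun q _)
    (fun x hx => u0 hx) hu hq (by
      rw [← horth]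
      refine setIntegral_congr_fun hK.measurableSet fun x hx => ?_
      simp only [sub_eq_zero.1 (hdu x (subset_closure hx))])
  intro x hx
  rw [sub_eq_zero.1 (hdu x hx), hu0 x hx]

lemma setIntegral_mul_polyFun_sum {ι : Type*} [Fintype ι] (hb : Bornology.IsBounded K)
    {d : Plane → ℝ} (cd : ContinuousOn d (closure K)) (p : ι → MvPolynomial (Fin 2) ℝ)
    (c : ι → ℝ) :
    ∫ x in K, d x * polyFun (∑ i, c i • p i) x = ∑ i, c i * ∫ x in K, d x * polyFun (p i) x := by
  simp only [polyFun_sum, polyFun_smul, Finset.mul_sum, mul_left_comm (d _)]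
  rw [integral_finsetSum _ fun i _ => (integrableOn_mul_of_continuousOn_closure hb cd
    (continuousOn_polyFun (p i) _)).const_mul (c i)]
  simp only [integral_const_mul]

lemma eq_zero_of_moments_eq_zero {ι : Type*} [Finite ι] {k : ℤ} (b : Module.Basis ι ℝ (Poly k))
    (hK : IsOpen K) (hb : Bornology.IsBounded K)
    (hseg : ∀ z ∈ frontier K, ∃ z', z ≠ z' ∧ Disjoint (segment ℝ z z') K)
    {d : Plane → ℝ} (cd : ContinuousOn d (closure K)) (h0 : ∀ x ∈ frontier K, d x = 0)
    (hw : ∃ q ∈ Poly k, HasWeakLaplacian d (polyFun q) K)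
    (horth : ∀ i, ∫ x in K, d x * polyFun (b i) x = 0) : ∀ x ∈ closure K, d x = 0 := by
  have := Fintype.ofFinite ι
  obtain ⟨q, hq, hw⟩ := hw
  refine eq_zero_of_hasWeakLaplacian_polyFun hK hb hseg cd h0 hw ?_
  have hsum := congrArg Subtype.val (b.sum_repr ⟨q, hq⟩)
  simp only [Submodule.coe_sum, Submodule.coe_smul] at hsum
  rw [← hsum, setIntegral_mul_polyFun_sum hb cd]
  simp [horth]

/-- The local problem with prescribed boundary values and moments is solvable. -/
theorem exists_hasWeakLaplacian_of_moments {ι : Type*} [Finite ι] {k : ℤ}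
    (b : Module.Basis ι ℝ (Poly k)) (hK : IsOpen K) (hne : K.Nonempty)
    (hb : Bornology.IsBounded K)
    (hseg : ∀ z ∈ frontier K, ∃ z', z ≠ z' ∧ Disjoint (segment ℝ z z') K)
    {g : Plane → ℝ} (cg : ContinuousOn g (frontier K)) (t : ι → ℝ) :
    ∃ v, ContinuousOn v (closure K) ∧ EqOn v g (frontier K) ∧
      (∃ q ∈ Poly k, HasWeakLaplacian v (polyFun q) K) ∧
      ∀ i, ∫ x in K, v x * polyFun (b i) x = t i := by
  have := Fintype.ofFinite ι
  obtain ⟨h, ch, hg, hs, hh⟩ := exists_laplacian_eq_polyFun hK hb hseg cg 0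
  choose u cu u0 us hu using fun i => exists_laplacian_eq_polyFun (g := 0) hK hb hseg
    continuousOn_const (b i : MvPolynomial (Fin 2) ℝ)
  -- The moment matrix is square: the correctors `u i` and the test polynomials share the index set,
  -- so injectivity will give surjectivity.
  let A : (ι → ℝ) →ₗ[ℝ] (ι → ℝ) :=
    Matrix.mulVecLin (Matrix.of fun j i => ∫ x in K, u i x * polyFun (b j) x)
  have cU : ∀ c : ι → ℝ, ContinuousOn (fun x => ∑ i, c i * u i x) (closure K) := fun c =>
    continuousOn_finsetSum _ fun i _ => continuousOn_const.mul (cu i)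
  have sU : ∀ c : ι → ℝ, ∀ x ∈ K, ContDiffAt ℝ ∞ (fun x => ∑ i, c i * u i x) x := fun c x hx =>
    ContDiffAt.sum fun i _ => contDiffAt_const.mul (us i x hx)
  have U0 : ∀ c : ι → ℝ, ∀ x ∈ frontier K, ∑ i, c i * u i x = 0 := fun c x hx =>
    Finset.sum_eq_zero fun i _ => by rw [u0 i hx]; simp
  have lU : ∀ c : ι → ℝ, ∀ x ∈ K, laplacian (fun x => ∑ i, c i * u i x) x =
      polyFun (∑ i, c i • (b i : MvPolynomial (Fin 2) ℝ)) x := fun c x hx => by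
    have hu2 : ∀ i, ContDiffAt ℝ 2 (u i) x := fun i => contDiffAt_infty.1 (us i x hx) 2
    have key : ∀ s : Finset ι, laplacian (fun x => ∑ i ∈ s, c i * u i x) x =
        ∑ i ∈ s, c i * laplacian (u i) x := by
      classical
      intro s
      induction s using Finset.induction_on with
      | empty => simp
      | insert i s hi ih =>
        simp only [Finset.sum_insert hi]
        have h1 : ContDiffAt ℝ 2 (c i • u i) x := (hu2 i).const_smul (c i)
        have h2 : ContDiffAt ℝ 2 (fun x => ∑ i ∈ s, c i * u i x) x :=
          ContDiffAt.sum fun i _ => contDiffAt_const.mul (hu2 i)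
        rw [← ih, ← smul_eq_mul, ← laplacian_smul (c i) (hu2 i), ← h1.laplacian_add h2]
        rfl
    rw [key, polyFun_sum]
    exact Finset.sum_congr rfl fun i _ => by rw [hu i x hx, polyFun_smul]
  have mU : ∀ (c : ι → ℝ) j, ∫ x in K, (∑ i, c i * u i x) * polyFun (b j) x = A c j := by
    intro c j
    simp only [Finset.sum_mul, mul_assoc]
    rw [integral_finsetSum _ fun i _ => (integrableOn_mul_of_continuousOn_closure hb (cu i)
      (continuousOn_polyFun (b j) _)).const_mul (c i)]
    simp only [integral_const_mul, A, Matrix.mulVecLin_apply, Matrix.mulVec, dotProduct,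
      Matrix.of_apply, mul_comm]
  -- If all moments of $U=\sum c_iu_i$ vanish, then $U$ is orthogonal to its own Laplacian $\sum
  -- c_ib_i$, so $U=0$. That polynomial then vanishes on `K`, and linear independence of the basis
  -- gives $c=0$.
  have hinj : Function.Injective A := by
    rw [← LinearMap.ker_eq_bot, LinearMap.ker_eq_bot']
    intro c hc
    have hz := eq_zero_of_integral_mul_laplacian_eq_zero hK hb (cU c) (continuousOn_polyFun _ _)
      (U0 c) (sU c) (lU c) (by
        rw [setIntegral_mul_polyFun_sum hb (cU c)]
        simp [mU, hc])
    have hq : ∑ i, c i • (b i : MvPolynomial (Fin 2) ℝ) = 0 := by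
      refine eq_zero_of_polyFun_eq_zero hK hne fun x hx => ?_
      rw [← lU c x hx]
      have : (fun x => ∑ i, c i * u i x) =ᶠ[𝓝 x] fun _ => 0 := by
        filter_upwards [hK.mem_nhds hx] with y hy using hz y (subset_closure hy)
      rw [(laplacian_congr_nhds this).eq_of_nhds]
      simp
    have hq' : ∑ i, c i • b i = 0 := by
      apply Subtype.ext
      simpa using hq
    exact funext fun i => Fintype.linearIndependent_iff.1 b.linearIndependent c hq' i
  obtain ⟨c, hc⟩ := (LinearMap.injective_iff_surjective.1 hinj)
    fun i => t i - ∫ x in K, h x * polyFun (b i) x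
  have cV : ContinuousOn (h + fun x => ∑ i, c i * u i x) (closure K) := ch.add (cU c)
  refine ⟨h + fun x => ∑ i, c i * u i x, cV, fun x hx => ?_,
    ⟨∑ i, c i • (b i : MvPolynomial (Fin 2) ℝ),
      Submodule.sum_mem _ fun i _ => Submodule.smul_mem _ _ (b i).2, ?_⟩, fun j => ?_⟩
  · rw [Pi.add_apply, U0 c x hx, add_zero, hg hx]
  · refine hasWeakLaplacian_of_contDiffAt hK (fun x hx => (hs x hx).add (sU c x hx)) fun x hx => ?_
    rw [(contDiffAt_infty.1 (hs x hx) 2).laplacian_add (contDiffAt_infty.1 (sU c x hx) 2),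
      hh x hx, lU c x hx]
    simp [polyFun]
  · simp only [Pi.add_apply, add_mul]
    rw [integral_add (integrableOn_mul_of_continuousOn_closure hb ch (continuousOn_polyFun _ _))
      (integrableOn_mul_of_continuousOn_closure hb (cU c) (continuousOn_polyFun _ _)), mU, hc]
    ring

end Local

end VEM

namespace VEM

open Filter Topology Metric Real

/-! ### Edges of the mesh -/

open Classical in
/-- The function on the segment from `A` to `B` which is affine, one at `ν` if `ν` is an end point,
and zero at the end points different from `ν`. -/
noncomputable def edgeHat (ν A B x : Plane) : ℝ :=
  if A = ν then dist x B / dist A B else if B = ν then dist x A / dist A B else 0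

lemma finRotate_ne {n : ℕ} (hn : 2 ≤ n) (a : Fin n) : finRotate n a ≠ a := by
  obtain ⟨m, rfl⟩ : ∃ m, n = m + 2 := ⟨n - 2, by omega⟩
  intro h
  rw [finRotate_apply] at h
  simp at h

lemma Element.edge_ne (K : Element) (a : Fin K.numVertices) :
    K.polygon a ≠ K.polygon (finRotate _ a) := fun h =>
  finRotate_ne (by have := K.simple.three_le; omega) a (K.simple.injective h).symm

lemma edgePath_eq_lineMap {n : ℕ} (P : Polygon Plane n) (a : Fin n) (t : ℝ) :
    P.edgePath ℝ a t = AffineMap.lineMap (P a) (P (finRotate n a)) t := rfl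

lemma edgePath_zero {n : ℕ} (P : Polygon Plane n) (a : Fin n) : P.edgePath ℝ a 0 = P a := by
  simp [edgePath_eq_lineMap]

lemma edgePath_mem_edgeSet {n : ℕ} (P : Polygon Plane n) (a : Fin n) {t : ℝ}
    (ht : t ∈ Icc (0 : ℝ) 1) : P.edgePath ℝ a t ∈ P.edgeSet ℝ a := mem_image_of_mem _ ht

lemma edgeSet_eq_segment {n : ℕ} (P : Polygon Plane n) (a : Fin n) :
    P.edgeSet ℝ a = segment ℝ (P a) (P (finRotate n a)) := affineSegment_eq_segment ℝ _ _

lemma isClosed_edgeSet {n : ℕ} (P : Polygon Plane n) (a : Fin n) : IsClosed (P.edgeSet ℝ a) := by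
  rw [Polygon.edgeSet_eq_image_edgePath ℝ P a]
  exact (isCompact_Icc.image (by
    change Continuous fun t : ℝ => AffineMap.lineMap (P a) (P (finRotate n a)) t
    fun_prop)).isClosed

open Classical in
lemma edgeHat_lineMap {ν A B : Plane} (h : A ≠ B) {t : ℝ} (ht : t ∈ Icc (0 : ℝ) 1) :
    edgeHat ν A B (AffineMap.lineMap A B t) =
      (1 - t) * (if A = ν then 1 else 0) + t * (if B = ν then 1 else 0) := by
  have hd : dist A B ≠ 0 := dist_ne_zero.2 h
  unfold edgeHat
  split_ifs with h1 h2 h2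
  · exact absurd (h1.trans h2.symm) h
  · rw [dist_lineMap_right, Real.norm_eq_abs, abs_of_nonneg (by linarith [ht.2]),
      mul_div_cancel_right₀ _ hd]
    ring
  · rw [dist_lineMap_left, Real.norm_eq_abs, abs_of_nonneg ht.1, mul_div_cancel_right₀ _ hd]
    ring
  · ring

lemma edgeHat_comm {A B : Plane} (h : A ≠ B) (ν x : Plane) : edgeHat ν A B x = edgeHat ν B A x := by
  unfold edgeHat
  rw [dist_comm B A]
  split_ifs with h1 h2 h2
  · exact absurd (h1.trans h2.symm) h
  all_goals rfl

open Classical in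
lemma edgeHat_endpoint {ν A B x : Plane} (h : A ≠ B) (hx : x = A ∨ x = B) :
    edgeHat ν A B x = if x = ν then 1 else 0 := by
  rcases hx with rfl | rfl
  · have := edgeHat_lineMap (ν := ν) h (t := 0) (by simp)
    simpa using this
  · have := edgeHat_lineMap (ν := ν) h (t := 1) (by simp)
    simpa using this

lemma continuous_edgeHat (ν A B : Plane) : Continuous (edgeHat ν A B) := by
  unfold edgeHat
  split_ifs <;> fun_prop

/-- If `C` and `D` have parameters `s` and `t` on the segment from `A` to `B`, then `A` lying
between them means $s+t=|s-t|$, so one of the parameters is 0. -/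
lemma eq_or_eq_of_segment_eq {A B C D : Plane}
    (h : segment ℝ A B = segment ℝ C D) : A = C ∨ A = D := by
  have hA : A ∈ segment ℝ C D := h ▸ left_mem_segment ℝ A B
  have hC : C ∈ segment ℝ A B := h ▸ left_mem_segment ℝ C D
  have hD : D ∈ segment ℝ A B := h ▸ right_mem_segment ℝ C D
  have hdist := (mem_segment_iff_wbtw.1 hA).dist_add_dist
  rw [segment_eq_image_lineMap] at hC hD
  obtain ⟨s, hs, rfl⟩ := hC
  obtain ⟨t, ht, rfl⟩ := hD
  rw [dist_lineMap_left, dist_left_lineMap, dist_lineMap_lineMap, Real.norm_eq_abs,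
    Real.norm_eq_abs, abs_of_nonneg hs.1, abs_of_nonneg ht.1, Real.dist_eq, ← add_mul] at hdist
  by_cases hAB : A = B
  · subst hAB
    simp
  have h1 := mul_right_cancel₀ (dist_ne_zero.2 hAB) hdist
  rcases abs_cases (s - t) with h2 | h2
  · right
    have : t = 0 := by linarith [h2.1]
    simp [this]
  · left
    have : s = 0 := by linarith [h2.1]
    simp [this]

lemma edgeHat_eq_of_segment_eq {A B C D : Plane} (hAB : A ≠ B) (hCD : C ≠ D)
    (h : segment ℝ A B = segment ℝ C D) (ν x : Plane) : edgeHat ν A B x = edgeHat ν C D x := by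
  have hA := eq_or_eq_of_segment_eq h
  have hB := eq_or_eq_of_segment_eq ((segment_symm ℝ B A).trans h)
  rcases hA with rfl | rfl <;> rcases hB with rfl | rfl
  · exact absurd rfl hAB
  · rfl
  · exact edgeHat_comm hAB ν x
  · exact absurd rfl hAB

section Mesh

variable {ι : Type*} {Ω : Set Plane} (T : Mesh ι Ω)

/-- The hat function of the vertex `ν` on the `a`-th edge of the `i`-th element. -/
noncomputable def Mesh.hat (ν : Plane) (i : ι) (a : Fin (T.elem i).numVertices) : Plane → ℝ :=
  edgeHat ν ((T.elem i).polygon a) ((T.elem i).polygon (finRotate _ a))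

/-- By conformity, two edges through `x` either coincide, and the hat does not depend on
orientation, or meet at a common endpoint, where both hats equal the indicator of `ν`. -/
lemma Mesh.hat_eq_hat (ν : Plane) {i j : ι} {a : Fin (T.elem i).numVertices}
    {b : Fin (T.elem j).numVertices} {x : Plane} (hx : x ∈ (T.elem i).polygon.edgeSet ℝ a)
    (hx' : x ∈ (T.elem j).polygon.edgeSet ℝ b) : T.hat ν i a x = T.hat ν j b x := by
  rcases T.conforming i j a b with h | h
  · rw [edgeSet_eq_segment, edgeSet_eq_segment] at h
    exact edgeHat_eq_of_segment_eq ((T.elem i).edge_ne a) ((T.elem j).edge_ne b) h ν x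
  · obtain ⟨h1, h2⟩ := h ⟨hx, hx'⟩
    rw [Mesh.hat, Mesh.hat, edgeHat_endpoint ((T.elem i).edge_ne a) h1,
      edgeHat_endpoint ((T.elem j).edge_ne b) h2]

open Classical in
/-- The hat function of the vertex `ν` on the union of all edges. -/
noncomputable def Mesh.skeletonHat (ν x : Plane) : ℝ :=
  if h : ∃ e : (i : ι) × Fin (T.elem i).numVertices, x ∈ (T.elem e.1).polygon.edgeSet ℝ e.2 then
    T.hat ν h.choose.1 h.choose.2 x else 0

lemma Mesh.skeletonHat_eq_hat (ν : Plane) {i : ι} {a : Fin (T.elem i).numVertices} {x : Plane}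
    (hx : x ∈ (T.elem i).polygon.edgeSet ℝ a) : T.skeletonHat ν x = T.hat ν i a x := by
  have h : ∃ e : (i : ι) × Fin (T.elem i).numVertices,
      x ∈ (T.elem e.1).polygon.edgeSet ℝ e.2 := ⟨⟨i, a⟩, hx⟩
  rw [Mesh.skeletonHat, dif_pos h]
  exact T.hat_eq_hat ν h.choose_spec hx

open Classical in
lemma Mesh.skeletonHat_edgePath (ν : Plane) (i : ι) (a : Fin (T.elem i).numVertices) {t : ℝ}
    (ht : t ∈ Icc (0 : ℝ) 1) : T.skeletonHat ν ((T.elem i).polygon.edgePath ℝ a t) =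
      (1 - t) * (if (T.elem i).polygon a = ν then 1 else 0) +
        t * (if (T.elem i).polygon (finRotate _ a) = ν then 1 else 0) := by
  rw [T.skeletonHat_eq_hat ν (edgePath_mem_edgeSet _ a ht)]
  exact edgeHat_lineMap ((T.elem i).edge_ne a) ht

end Mesh

lemma Element.mem_frontier_iff (K : Element) {x : Plane} :
    x ∈ frontier K.carrier ↔ ∃ a, ∃ t ∈ Icc (0 : ℝ) 1, K.polygon.edgePath ℝ a t = x := by
  rw [K.frontier_eq, Polygon.boundary, mem_iUnion]
  rfl

lemma Element.edgePath_mem_frontier (K : Element) (a : Fin K.numVertices) {t : ℝ}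
    (ht : t ∈ Icc (0 : ℝ) 1) : K.polygon.edgePath ℝ a t ∈ frontier K.carrier :=
  K.mem_frontier_iff.2 ⟨a, t, ht, rfl⟩

lemma Element.vertex_mem_frontier (K : Element) (a : Fin K.numVertices) :
    K.polygon a ∈ frontier K.carrier := by
  rw [← edgePath_zero]
  exact K.edgePath_mem_frontier a (by simp)

/-- This is the barrier condition. A boundary point lies on an edge, the edge is in the frontier and
hence misses the open element, and at least one end of the edge differs from the point. -/
lemma Element.exists_segment (K : Element) : ∀ z ∈ frontier K.carrier,
    ∃ z', z ≠ z' ∧ Disjoint (segment ℝ z z') K.carrier := by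
  intro z hz
  have hz' := hz
  rw [K.frontier_eq, Polygon.boundary, mem_iUnion] at hz'
  obtain ⟨a, ha⟩ := hz'
  have hsub : K.polygon.edgeSet ℝ a ⊆ frontier K.carrier := by
    rw [K.frontier_eq]
    exact subset_iUnion (K.polygon.edgeSet ℝ) a
  rw [edgeSet_eq_segment] at ha hsub
  have hdisj : ∀ z' ∈ segment ℝ (K.polygon a) (K.polygon (finRotate _ a)),
      Disjoint (segment ℝ z z') K.carrier := fun z' hz' =>
    (disjoint_frontier_iff_isOpen.2 K.isOpen).mono_left
      (((convex_segment _ _).segment_subset ha hz').trans hsub)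
  by_cases h : z = K.polygon a
  · exact ⟨_, h ▸ K.edge_ne a, hdisj _ (right_mem_segment ℝ _ _)⟩
  · exact ⟨_, h, hdisj _ (left_mem_segment ℝ _ _)⟩

lemma Mesh.continuousOn_skeletonHat {ι : Type*} {Ω : Set Plane} (T : Mesh ι Ω) (ν : Plane)
    (i : ι) : ContinuousOn (T.skeletonHat ν) (frontier (T.elem i).carrier) := by
  rw [(T.elem i).frontier_eq, Polygon.boundary]
  refine (locallyFinite_of_finite _).continuousOn_iUnion (isClosed_edgeSet _) fun a => ?_
  exact (continuous_edgeHat _ _ _).continuousOn.congr fun x hx => T.skeletonHat_eq_hat ν hx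

lemma Element.volume_pos (K : Element) : 0 < volume.real K.carrier :=
  ENNReal.toReal_pos (K.isOpen.measure_pos volume K.isConnected.nonempty).ne'
    K.isBounded.measure_lt_top.ne

lemma HasWeakLaplacian.congr {u v g : Plane → ℝ} {K : Set Plane} (hK : IsOpen K)
    (hu : HasWeakLaplacian u g K) (h : EqOn u v K) : HasWeakLaplacian v g K := by
  intro η h1 h2 h3
  rw [← hu η h1 h2 h3]
  exact setIntegral_congr_fun hK.measurableSet fun x hx => by simp only [h hx]

end VEM

namespace VEM

open Filter Topology Metric Real

section Mesh

variable {ι : Type*} {Ω : Set Plane} (T : Mesh ι Ω)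

/-! ### Existence of the vertex functions -/

open Classical in
lemma Mesh.skeletonHat_vertex (ν : Plane) (i : ι) (a : Fin (T.elem i).numVertices) :
    T.skeletonHat ν ((T.elem i).polygon a) = if (T.elem i).polygon a = ν then 1 else 0 := by
  have := T.skeletonHat_edgePath ν i a (t := 0) (by simp)
  rw [edgePath_zero] at this
  simpa using this

lemma Mesh.skeletonHat_eq_zero {ν : Plane} {i : ι} (hν : ν ∉ (T.elem i).vertexSet) :
    ∀ x ∈ frontier (T.elem i).carrier, T.skeletonHat ν x = 0 := by
  intro x hx
  obtain ⟨a, t, ht, rfl⟩ := (T.elem i).mem_frontier_iff.1 hx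
  have h : ∀ b, (T.elem i).polygon b ≠ ν := fun b hb => hν ⟨b, hb⟩
  rw [T.skeletonHat_edgePath ν i a ht, if_neg (h _), if_neg (h _)]
  simp

lemma Mesh.mem_frontier_of_mem_closure {i j : ι} (hij : i ≠ j) {x : Plane}
    (hi : x ∈ closure (T.elem i).carrier) (hj : x ∈ closure (T.elem j).carrier) :
    x ∈ frontier (T.elem i).carrier := by
  rw [(T.elem i).isOpen.frontier_eq]
  exact ⟨hi, fun hx => ((T.disjoint i j hij).closure_right (T.elem i).isOpen).le_bot ⟨hx, hj⟩⟩

/-- Continuous functions on the closed elements with the same values on the skeleton can be glued. -/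
lemma Mesh.exists_glue (v : ι → Plane → ℝ) (g : Plane → ℝ)
    (hv : ∀ i, EqOn (v i) g (frontier (T.elem i).carrier)) :
    ∃ φ : Plane → ℝ, ∀ i, EqOn φ (v i) (closure (T.elem i).carrier) := by
  classical
  refine ⟨fun x => if h : ∃ i, x ∈ closure (T.elem i).carrier then v h.choose x else 0,
    fun i x hx => ?_⟩
  have h : ∃ i, x ∈ closure (T.elem i).carrier := ⟨i, hx⟩
  simp only [dif_pos h]
  by_cases hij : h.choose = i
  · rw [hij]
  · rw [hv _ (T.mem_frontier_of_mem_closure hij h.choose_spec hx),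
      hv _ (T.mem_frontier_of_mem_closure (Ne.symm hij) hx h.choose_spec)]

lemma hasWeakLaplacian_zero (K : Set Plane) : HasWeakLaplacian (fun _ => 0) (polyFun 0) K := by
  intro η _ _ _
  simp [polyFun]

/-- If `ν` is not a vertex of the element, its hat vanishes on the whole boundary, so the zero
function has the right trace. Otherwise the local problem is solved with the moments freed of the
factor $1/|K|$. -/
lemma Mesh.exists_local_vertexFunction (p : ℕ) (m : T.MomentBasis p) (ν : Plane) (i : ι) :
    ∃ v : Plane → ℝ, ContinuousOn v (closure (T.elem i).carrier) ∧
      EqOn v (T.skeletonHat ν) (frontier (T.elem i).carrier) ∧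
      (∃ q ∈ Poly ((p : ℤ) - 2), HasWeakLaplacian v (polyFun q) (T.elem i).carrier) ∧
      (ν ∈ (T.elem i).vertexSet → ∀ α, ∫ x in (T.elem i).carrier, v x * polyFun (m i α) x =
        1 / ((T.elem i).numVertices : ℝ) * ∫ x in (T.elem i).carrier, polyFun (m i α) x) ∧
      (ν ∉ (T.elem i).vertexSet → ∀ x, v x = 0) := by
  by_cases hν : ν ∈ (T.elem i).vertexSet
  · have := finite_multiIndex ((p : ℤ) - 2)
    obtain ⟨v, h1, h2, h3, h4⟩ := exists_hasWeakLaplacian_of_moments (m i) (T.elem i).isOpen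
      (T.elem i).isConnected.nonempty (T.elem i).isBounded (T.elem i).exists_segment
      (T.continuousOn_skeletonHat ν i) fun α =>
        1 / ((T.elem i).numVertices : ℝ) * ∫ x in (T.elem i).carrier, polyFun (m i α) x
    exact ⟨v, h1, h2, h3, fun _ => h4, fun h => absurd hν h⟩
  · exact ⟨fun _ => 0, continuousOn_const, fun x hx => (T.skeletonHat_eq_zero hν x hx).symm,
      ⟨0, Submodule.zero_mem _, hasWeakLaplacian_zero _⟩, fun h => absurd h hν, fun _ _ => rfl⟩

variable [Fintype ι]

lemma Mesh.mem_vertices {ν : Plane} : ν ∈ T.vertices ↔ ∃ i, ν ∈ (T.elem i).vertexSet := by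
  simp [Mesh.vertices, Element.vertexSet]

lemma Mesh.vertex_mem_vertices (i : ι) (a : Fin (T.elem i).numVertices) :
    (T.elem i).polygon a ∈ T.vertices := T.mem_vertices.2 ⟨i, a, rfl⟩

theorem Mesh.exists_isVertexFunction {p : ℕ} (hp : 1 ≤ p) (m : T.MomentBasis p) {ν : Plane}
    (hν : ν ∈ T.vertices) : ∃ φ, T.IsVertexFunction p m ν φ := by
  choose v cv hv wv mv zv using T.exists_local_vertexFunction p m ν
  obtain ⟨φ, hφ⟩ := T.exists_glue v (T.skeletonHat ν) hv
  have hfr : ∀ i, EqOn φ (T.skeletonHat ν) (frontier (T.elem i).carrier) := fun i x hx =>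
    (hφ i (frontier_subset_closure hx)).trans (hv i hx)
  have hvert : ∀ i a, φ ((T.elem i).polygon a) = T.skeletonHat ν ((T.elem i).polygon a) :=
    fun i a => hfr i ((T.elem i).vertex_mem_frontier a)
  have hedge : ∀ (i : ι) (a : Fin (T.elem i).numVertices), ∀ t ∈ Icc (0 : ℝ) 1,
      φ ((T.elem i).polygon.edgePath ℝ a t) =
        (1 - t) * φ ((T.elem i).polygon a) + t * φ ((T.elem i).polygon (finRotate _ a)) := by
    intro i a t ht
    rw [hfr i ((T.elem i).edgePath_mem_frontier a ht), hvert, hvert, T.skeletonHat_vertex,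
      T.skeletonHat_vertex, T.skeletonHat_edgePath ν i a ht]
  have cφ : ∀ i, ContinuousOn φ (closure (T.elem i).carrier) := fun i => (cv i).congr (hφ i)
  have hmem : ∀ i, EqOn φ (v i) (T.elem i).carrier := fun i => (hφ i).mono subset_closure
  refine ⟨φ, ⟨?_, fun i => ⟨cφ i, fun a => ?_, ?_⟩⟩, ?_, ?_, hedge, ?_, ?_⟩
  · rw [T.closure_eq]
    exact (locallyFinite_of_finite _).continuousOn_iUnion (fun i => isClosed_closure) cφ
  · set A := φ ((T.elem i).polygon a)
    set B := φ ((T.elem i).polygon (finRotate _ a))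
    -- The affine trace has degree at most 1, which is where $p\ge 1$ enters.
    refine ⟨Polynomial.C (B - A) * Polynomial.X + Polynomial.C A,
      Polynomial.natDegree_linear_le.trans hp, fun t ht => ?_⟩
    rw [hedge i a t ht]
    simp only [Polynomial.eval_add, Polynomial.eval_mul, Polynomial.eval_C, Polynomial.eval_X]
    ring
  · obtain ⟨q, hq, hw⟩ := wv i
    exact ⟨q, hq, hw.congr (T.elem i).isOpen (hmem i).symm⟩
  · obtain ⟨i, a, rfl⟩ := T.mem_vertices.1 hν
    rw [hvert, T.skeletonHat_vertex, if_pos rfl]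
  · intro μ hμ hne
    obtain ⟨i, a, rfl⟩ := T.mem_vertices.1 hμ
    rw [hvert, T.skeletonHat_vertex, if_neg hne]
  · intro i hi α
    rw [setIntegral_congr_fun (T.elem i).isOpen.measurableSet fun x hx => by
      rw [hmem i hx], mv i hi α]
    rw [← mul_assoc, one_div_mul_one_div_rev]
  · intro i hi x hx
    rw [hφ i hx, zv i hi]

/-! ### Uniqueness and the partition of unity -/

variable {T} {p : ℕ} {m : T.MomentBasis p} {ν : Plane} {φ ψ : Plane → ℝ}

open Classical in
lemma Mesh.IsVertexFunction.apply_edgePath (h : T.IsVertexFunction p m ν φ) (i : ι)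
    (a : Fin (T.elem i).numVertices) {t : ℝ} (ht : t ∈ Icc (0 : ℝ) 1) :
    φ ((T.elem i).polygon.edgePath ℝ a t) =
      (1 - t) * (if (T.elem i).polygon a = ν then 1 else 0) +
        t * (if (T.elem i).polygon (finRotate _ a) = ν then 1 else 0) := by
  have hv : ∀ b, φ ((T.elem i).polygon b) = if (T.elem i).polygon b = ν then 1 else 0 := by
    intro b
    split_ifs with hb
    · rw [hb, h.at_self]
    · exact h.at_other _ (T.vertex_mem_vertices i b) hb
  rw [h.affine i a t ht, hv, hv]

lemma Mesh.IsVertexFunction.continuousOn (h : T.IsVertexFunction p m ν φ) (i : ι) :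
    ContinuousOn φ (closure (T.elem i).carrier) := (h.mem_space.2 i).continuousOn

open Classical in
-- Since $|K|>0$ cancels, the moment condition and the vanishing condition combine into one formula
-- valid on every element.
lemma Mesh.IsVertexFunction.integral_mul (h : T.IsVertexFunction p m ν φ) (i : ι) (α) :
    ∫ x in (T.elem i).carrier, φ x * polyFun (m i α) x =
      if ν ∈ (T.elem i).vertexSet then
        1 / ((T.elem i).numVertices : ℝ) * ∫ x in (T.elem i).carrier, polyFun (m i α) x
      else 0 := by
  split_ifs with hν
  · have h1 := h.moments i hν α
    have h2 := (T.elem i).volume_pos.ne'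
    rw [← one_div_mul_one_div_rev, mul_assoc] at h1
    exact mul_left_cancel₀ (one_div_ne_zero h2) h1
  · rw [setIntegral_congr_fun (g := fun _ => 0) (T.elem i).isOpen.measurableSet fun x hx => by
      simp only [h.eq_zero i hν x (subset_closure hx), zero_mul]]
    simp

lemma Element.eq_zero_of_moments (K : Element) {k : ℤ} {J : Type*} [Finite J]
    (b : Module.Basis J ℝ (Poly k)) {d : Plane → ℝ} (cd : ContinuousOn d (closure K.carrier))
    (h0 : ∀ a, ∀ t ∈ Icc (0 : ℝ) 1, d (K.polygon.edgePath ℝ a t) = 0)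
    (hw : ∃ q ∈ Poly k, HasWeakLaplacian d (polyFun q) K.carrier)
    (horth : ∀ i, ∫ x in K.carrier, d x * polyFun (b i) x = 0) : ∀ x ∈ closure K.carrier, d x = 0 :=
  eq_zero_of_moments_eq_zero b K.isOpen K.isBounded K.exists_segment cd (fun x hx => by
    obtain ⟨a, t, ht, rfl⟩ := K.mem_frontier_iff.1 hx
    exact h0 a t ht) hw horth

theorem Mesh.IsVertexFunction.eqOn (hφ : T.IsVertexFunction p m ν φ)
    (hψ : T.IsVertexFunction p m ν ψ) : EqOn φ ψ (closure Ω) := by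
  intro x hx
  rw [T.closure_eq, mem_iUnion] at hx
  obtain ⟨i, hx⟩ := hx
  have := finite_multiIndex ((p : ℤ) - 2)
  obtain ⟨q, hq, hw⟩ := (hφ.mem_space.2 i).laplacian
  obtain ⟨q', hq', hw'⟩ := (hψ.mem_space.2 i).laplacian
  have hb := (T.elem i).isBounded
  refine sub_eq_zero.1 ((T.elem i).eq_zero_of_moments (m i) (d := fun x => φ x - ψ x)
    ((hφ.continuousOn i).sub (hψ.continuousOn i)) (fun a t ht => ?_)
    ⟨q - q', Submodule.sub_mem _ hq hq', ?_⟩ (fun α => ?_) x hx)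
  · rw [hφ.apply_edgePath i a ht, hψ.apply_edgePath i a ht, sub_self]
  · have := hw.sub hb hw' (hφ.continuousOn i) (hψ.continuousOn i) (continuousOn_polyFun q _)
      (continuousOn_polyFun q' _)
    simpa only [← polyFun_sub] using this
  · simp only [sub_mul]
    rw [integral_sub (integrableOn_mul_of_continuousOn_closure hb (hφ.continuousOn i)
        (continuousOn_polyFun _ _))
      (integrableOn_mul_of_continuousOn_closure hb (hψ.continuousOn i) (continuousOn_polyFun _ _)),
      hφ.integral_mul, hψ.integral_mul, sub_self]

open Classical in
-- The vertices of a simple polygon are distinct, so exactly $N^K$ mesh vertices contribute on `K`;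
-- this count cancels the factor $1/N^K$ in the moments.
lemma Mesh.card_filter_vertexSet (T : Mesh ι Ω) (i : ι) :
    (T.vertices.filter (· ∈ (T.elem i).vertexSet)).card = (T.elem i).numVertices := by
  have : T.vertices.filter (· ∈ (T.elem i).vertexSet) =
      Finset.univ.image (T.elem i).polygon.vertices := by
    ext x
    simp only [Finset.mem_filter, T.mem_vertices, Finset.mem_image, Finset.mem_univ, true_and]
    exact ⟨fun h => h.2, fun h => ⟨⟨i, h⟩, h⟩⟩
  rw [this, Finset.card_image_of_injective _ (T.elem i).simple.injective]
  simp

theorem Mesh.sum_vertexFunctions_eq_one (φ : Plane → Plane → ℝ)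
    (hφ : ∀ ν ∈ T.vertices, T.IsVertexFunction p m ν (φ ν)) :
    ∀ x ∈ closure Ω, ∑ ν ∈ T.vertices, φ ν x = 1 := by
  classical
  intro x hx
  rw [T.closure_eq, mem_iUnion] at hx
  obtain ⟨i, hx⟩ := hx
  have := finite_multiIndex ((p : ℤ) - 2)
  -- The polynomial is chosen for every point of the plane, with 0 as a filler off the vertex set,
  -- so that the choice is a plain function of `ν`.
  have hlap : ∀ ν, ∃ q ∈ Poly ((p : ℤ) - 2), ν ∈ T.vertices →
      HasWeakLaplacian (φ ν) (polyFun q) (T.elem i).carrier := fun ν => by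
    by_cases hν : ν ∈ T.vertices
    · obtain ⟨q, hq, hw⟩ := ((hφ ν hν).mem_space.2 i).laplacian
      exact ⟨q, hq, fun _ => hw⟩
    · exact ⟨0, Submodule.zero_mem _, fun h => absurd h hν⟩
  choose q hq hw using hlap
  have hb := (T.elem i).isBounded
  have hc : ∀ ν ∈ T.vertices, ContinuousOn (φ ν) (closure (T.elem i).carrier) := fun ν hν =>
    (hφ ν hν).continuousOn i
  have hcs : ContinuousOn (fun x => ∑ ν ∈ T.vertices, φ ν x) (closure (T.elem i).carrier) :=
    continuousOn_finsetSum _ hc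
  refine sub_eq_zero.1 ((T.elem i).eq_zero_of_moments (m i)
    (d := fun x => ∑ ν ∈ T.vertices, φ ν x - 1) (hcs.sub continuousOn_const) (fun a t ht => ?_)
    ⟨∑ ν ∈ T.vertices, q ν, Submodule.sum_mem _ fun ν _ => hq ν, ?_⟩ (fun α => ?_) x hx)
  -- Each of the two ends of the edge is hit by exactly one `ν`, so the sum is $(1-t)+t=1$.
  · rw [Finset.sum_congr rfl fun ν hν => (hφ ν hν).apply_edgePath i a ht, Finset.sum_add_distrib,
      ← Finset.mul_sum, ← Finset.mul_sum]
    simp [T.vertex_mem_vertices]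
  · have h1 := HasWeakLaplacian.sum hb (fun ν hν => hw ν hν) hc
      (fun ν _ => continuousOn_polyFun (q ν) _)
    have h2 : HasWeakLaplacian (fun _ => (1 : ℝ)) (fun _ => 0) (T.elem i).carrier :=
      hasWeakLaplacian_of_contDiffAt (T.elem i).isOpen (fun x _ => contDiffAt_const)
        fun x _ => by simp
    have := h1.sub hb h2 hcs continuousOn_const
      (continuousOn_finsetSum _ fun ν _ => continuousOn_polyFun (q ν) _) continuousOn_const
    simpa only [← polyFun_sum, sub_zero] using this
  · simp only [sub_mul, Finset.sum_mul, one_mul]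
    have hi : ∀ ν ∈ T.vertices, IntegrableOn (fun x => φ ν x * polyFun (m i α) x)
        (T.elem i).carrier := fun ν hν =>
      integrableOn_mul_of_continuousOn_closure hb (hc ν hν) (continuousOn_polyFun _ _)
    have hN : ((T.elem i).numVertices : ℝ) ≠ 0 := by
      have := (T.elem i).simple.three_le
      positivity
    rw [integral_sub (integrable_finsetSum _ hi)
      (integrableOn_of_continuousOn_closure hb (continuousOn_polyFun _ _)),
      integral_finsetSum _ hi, Finset.sum_congr rfl fun ν hν => (hφ ν hν).integral_mul i α,
      ← Finset.sum_filter, Finset.sum_const, T.card_filter_vertexSet, nsmul_eq_mul]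
    field_simp
    simp

end Mesh

end VEM

theorem mainTheorem8 {ι : Type*} [Fintype ι] {Ω : Set VEM.Plane}
    (hΩ : VEM.IsPolygonalDomain Ω) (T : VEM.Mesh ι Ω) (p : ℕ) (hp : 1 ≤ p)
    (m : T.MomentBasis p) :
    -- every vertex has its function, and it is unique as a function on the closed domain
    (∀ ν ∈ T.vertices,
      (∃ φ : VEM.Plane → ℝ, T.IsVertexFunction p m ν φ) ∧
      (∀ φ ψ : VEM.Plane → ℝ, T.IsVertexFunction p m ν φ → T.IsVertexFunction p m ν ψ →
        Set.EqOn φ ψ (closure Ω))) ∧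
    -- the vertex functions sum up to one on the closed domain
    (∀ φ : VEM.Plane → VEM.Plane → ℝ,
      (∀ ν ∈ T.vertices, T.IsVertexFunction p m ν (φ ν)) →
        ∀ x ∈ closure Ω, ∑ ν ∈ T.vertices, φ ν x = 1) := by
  exact ⟨fun ν hν => ⟨T.exists_isVertexFunction hp m hν, fun _ _ hφ hψ => hφ.eqOn hψ⟩,
    T.sum_vertexFunctions_eq_one⟩
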